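/- Let $d\ge 1$, $\beta\in(0,1]$ and $K>0$. Let $\mathcal H^\beta_K(\mathbb R^d,\mathbb R)$ be the set of $a\in C^{\lfloor\beta\rfloor}(\mathbb R^d,\mathbb R)$ with $$\sum_{|\nu|\le\lfloor\beta\rfloor}\|\partial^\nu a\|_{\infty}+\sum_{|\nu|=\lfloor\beta\rfloor}\ \sup_{x\ne y}\frac{|\partial^\nu a(x)-\partial^\nu a(y)|}{\|x-y\|^{\beta-\lfloor\beta\rfloor}}\le K .$$ There is a constant $C>0$, depending only on $d$, $\beta$ and $K$, such that the following holds. Let $a\in\mathcal H^\beta_K(\mathbb R^d,\mathbb R)$ and let $p:\mathbb R^d\to[0,\infty)$ be a probability density (with respect to Lebesgue measure) of one of the following two forms. - Gaussian potential: $p(x)=\exp(-\|x\|^2/2+a(x))$ for all $x\in\mathbb R^d$. - Ball potential: $p(x)=\exp(-u(\|x\|^2)+a(x))$ for $\|x\|<1$ and $p(x)=0$ for $\|x\|\ge1$, where $u\in C^{m}([0,1),[0,\infty))$, $m=(\lfloor\beta\rfloor+1)\vee 2$, satisfies $u(t)\ge(1-t)^{-1/K}$ and $0\le u^{(l)}(t)\le(1-t)^{-(K+l)}$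 for all $t\in[0,1)$ and $l\in\{1,\dots,m\}$. For $t>0$ let $\mu_t$ be the density of the law of $Y_t$, where $dY_t=-Y_t\,dt+\sqrt2\,dB_t$ is the Ornstein–Uhlenbeck process with $Y_0\sim p$; that is, $Y_t$ has the law of $e^{-t}X+\sqrt{1-e^{-2t}}\,Z$ with $X\sim p$ and $Z\sim N(0,\mathrm{Id})$ independent. Let $s(t,x)=\nabla_x\log\mu_t(x)$ be the score, and let $\lambda_{\max}$ denote the largest eigenvalue of a symmetric matrix. Then for all $t>0$ the density $\mu_t$ is positive and of class $C^2$ on $\mathbb R^d$, and $$\sup_{x\in\mathbb R^d}\lambda_{\max}\big(\nabla s(t,x)+\mathrm{Id}\big)\le L(t):=Ce^{-t}\big(1+t^{\beta/2-1}\big).$$ Here $L$ is integrable on $(0,\infty)$, and the score satisfies the one-sided Lipschitz bound $$\langle s(t,x)-s(t,y),x-y\rangle\le (L(t)-1)\|x-y\|^2\qquad\text{for all }x,y\in\mathbb R^d .$$ -/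

import Mathlib

open MeasureTheory ProbabilityTheory Set
open scoped ENNReal RealInnerProductSpace

noncomputable section

namespace OUScore

/-- The Euclidean space `ℝ^d`. -/
abbrev E (d : ℕ) : Type := EuclideanSpace ℝ (Fin d)

variable {d : ℕ}

/-! ### Hölder balls -/

/-- The partial derivative `∂ f / ∂ x_i`. -/
def partialDeriv (i : Fin d) (f : E d → ℝ) : E d → ℝ :=
  fun x => fderiv ℝ f x (EuclideanSpace.single i 1)

/-- `∂^ν f = ∂^{|ν|} f / ∂ x_1^{ν_1} ⋯ ∂ x_d^{ν_d}` for a multi-index `ν`. -/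
def multiDeriv (ν : Fin d → ℕ) (f : E d → ℝ) : E d → ℝ :=
  (List.finRange d).foldr (fun i g => (partialDeriv i)^[ν i] g) f

/-- The supremum norm; it is only used for continuous functions, for which it is the
`L^∞` norm. -/
def supNorm (g : E d → ℝ) : ℝ≥0∞ := ⨆ x, ‖g x‖ₑ

/-- The Hölder seminorm `sup_{x ≠ y} |g x - g y| / ‖x - y‖ ^ s`. -/
def holderSeminorm (s : ℝ) (g : E d → ℝ) : ℝ≥0∞ :=
  ⨆ (x : E d) (y : E d) (_ : x ≠ y), ENNReal.ofReal (|g x - g y| / ‖x - y‖ ^ s)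

/-- The norm of the Hölder space `H^η(ℝ^d, ℝ)`: the sum of `‖∂^ν f‖_∞` over `|ν| ≤ ⌊η⌋`, plus the
sum over `|ν| = ⌊η⌋` of the Hölder seminorms of exponent `η - ⌊η⌋` of `∂^ν f`. -/
def holderNorm (η : ℝ) (f : E d → ℝ) : ℝ≥0∞ :=
  (∑ k ∈ Finset.range (⌊η⌋₊ + 1), ∑ ν ∈ Finset.piAntidiag (Finset.univ : Finset (Fin d)) k,
      supNorm (multiDeriv ν f)) +
    ∑ ν ∈ Finset.piAntidiag (Finset.univ : Finset (Fin d)) ⌊η⌋₊,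
      holderSeminorm (η - ⌊η⌋₊) (multiDeriv ν f)

/-- The ball of radius `K` of the Hölder space `H^η(ℝ^d, ℝ)`. -/
def HolderBall (d : ℕ) (η K : ℝ) : Set (E d → ℝ) :=
  {f | ContDiff ℝ (⌊η⌋₊ : ℕ) f ∧ holderNorm η f ≤ ENNReal.ofReal K}

/-! ### The densities -/

/-- `p` is a probability density function with respect to Lebesgue measure. -/
structure IsProbDensity (p : E d → ℝ) : Prop where
  measurable : Measurable p
  nonneg : ∀ x, 0 ≤ p x
  lintegral_eq_one : ∫⁻ x, ENNReal.ofReal (p x) = 1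

/-- The conditions on the radial profile `u : [0, 1) → [0, ∞)` of a ball potential:
`u` is of class `C^m` on `[0, 1)` with `m = max (⌊β⌋ + 1) 2`, `u t ≥ (1 - t)^{-1/K}` and
`0 ≤ u^{(l)} t ≤ (1 - t)^{-(K + l)}` for `1 ≤ l ≤ m`. At `t = 0` derivatives are one-sided. -/
structure IsBallProfile (β K : ℝ) (u : ℝ → ℝ) : Prop where
  contDiffOn : ContDiffOn ℝ ((⌊β⌋₊ + 1) ⊔ 2 : ℕ) u (Ico 0 1)
  lower : ∀ t ∈ Ico (0 : ℝ) 1, (1 - t) ^ (-(1 / K)) ≤ u t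
  deriv_nonneg : ∀ l ∈ Finset.Icc 1 ((⌊β⌋₊ + 1) ⊔ 2), ∀ t ∈ Ico (0 : ℝ) 1,
    0 ≤ iteratedDerivWithin l u (Ico 0 1) t
  deriv_le : ∀ l ∈ Finset.Icc 1 ((⌊β⌋₊ + 1) ⊔ 2), ∀ t ∈ Ico (0 : ℝ) 1,
    iteratedDerivWithin l u (Ico 0 1) t ≤ (1 - t) ^ (-(K + l))

/-- `p = exp (-‖x‖² / 2 + a)` on `ℝ^d`. -/
def HasGaussianPotential (p a : E d → ℝ) : Prop :=
  ∀ x, p x = Real.exp (-(‖x‖ ^ 2 / 2) + a x)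

/-- `p = exp (-u (‖x‖²) + a)` on the open unit ball and `p = 0` outside, for a profile `u` as
above. -/
def HasBallPotential (β K : ℝ) (p a : E d → ℝ) : Prop :=
  ∃ u : ℝ → ℝ, IsBallProfile β K u ∧
    (∀ x, ‖x‖ < 1 → p x = Real.exp (-u (‖x‖ ^ 2) + a x)) ∧ ∀ x, 1 ≤ ‖x‖ → p x = 0

/-! ### The Ornstein–Uhlenbeck flow and its score -/

/-- The probability measure with density `p`. -/
def densityMeasure (p : E d → ℝ) : Measure (E d) :=
  volume.withDensity fun x => ENNReal.ofReal (p x)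

/-- The law at time `t` of the Ornstein–Uhlenbeck process `dY = -Y dt + √2 dB` with `Y_0 ∼ p`,
that is, of `e^{-t} X + √(1 - e^{-2t}) Z` with `X ∼ p`, `Z ∼ N(0, Id)` independent. -/
def ouLaw (p : E d → ℝ) (t : ℝ) : Measure (E d) :=
  ((densityMeasure p).prod (stdGaussian (E d))).map
    fun w => Real.exp (-t) • w.1 + Real.sqrt (1 - Real.exp (-2 * t)) • w.2

/-- The density at `x` of the Gaussian measure on `ℝ^d` with mean `m` and covariance `v Id`. -/
def gaussianDensity (m : E d) (v : ℝ) (x : E d) : ℝ :=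
  (2 * Real.pi * v) ^ (-(d : ℝ) / 2) * Real.exp (-(‖x - m‖ ^ 2 / (2 * v)))

/-- The density of `ouLaw p t`, for `t > 0` (see `ouLaw_eq_withDensity`). -/
def ouDensity (p : E d → ℝ) (t : ℝ) (x : E d) : ℝ :=
  ∫ y, p y * gaussianDensity (Real.exp (-t) • y) (1 - Real.exp (-2 * t)) x

lemma gaussianDensity_nonneg (m : E d) {v : ℝ} (hv : 0 < v) (x : E d) :
    0 ≤ gaussianDensity m v x := by
  unfold gaussianDensity; positivity

lemma measurable_gaussianDensity_uncurry (s v : ℝ) :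
    Measurable fun w : E d × E d => gaussianDensity (s • w.1) v w.2 := by
  unfold gaussianDensity; fun_prop

lemma integral_gaussianDensity_mul_cexp (m : E d) {v : ℝ} (hv : 0 < v) (t : E d) :
    ∫ x, (gaussianDensity m v x : ℂ) * Complex.exp (⟪x, t⟫ * Complex.I) =
      Complex.exp (⟪m, t⟫ * Complex.I - v * ‖t‖ ^ 2 / 2) := by
  rw [← integral_add_right_eq_self _ m]
  have hb : 0 < ((1 / (2 * v) : ℝ) : ℂ).re := by
    rw [Complex.ofReal_re]; positivity
  have h := GaussianFourier.integral_cexp_neg_mul_sq_norm_add hb Complex.I t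
  have e : ∀ x : E d, (gaussianDensity m v (x + m) : ℂ) * Complex.exp (⟪x + m, t⟫ * Complex.I) =
      (((2 * Real.pi * v) ^ (-(d : ℝ) / 2) : ℝ) * Complex.exp (⟪m, t⟫ * Complex.I)) *
        Complex.exp (-((1 / (2 * v) : ℝ) : ℂ) * ‖x‖ ^ 2 + Complex.I * ⟪t, x⟫) := by
    intro x
    simp only [gaussianDensity, add_sub_cancel_right, inner_add_left, real_inner_comm x t]
    push_cast
    rw [mul_assoc, mul_assoc _ (Complex.exp _) (Complex.exp _), ← Complex.exp_add,
      ← Complex.exp_add]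
    congr 2
    field_simp
    ring
  simp_rw [e]
  rw [integral_const_mul, h]
  have hp : (Real.pi / ((1 / (2 * v) : ℝ) : ℂ)) = ((2 * Real.pi * v : ℝ) : ℂ) := by
    push_cast; field_simp
  have hpos : 0 < 2 * Real.pi * v := by positivity
  have hd : ((Module.finrank ℝ (E d) : ℂ) / 2) = (((d : ℝ) / 2 : ℝ) : ℂ) := by
    simp
  rw [hp, hd, ← Complex.ofReal_cpow hpos.le]
  rw [show (-(d : ℝ) / 2) = -((d : ℝ) / 2) by ring, Real.rpow_neg hpos.le]
  have hne : (2 * Real.pi * v) ^ ((d : ℝ) / 2) ≠ 0 := by positivity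
  have hne' : (((2 * Real.pi * v) ^ ((d : ℝ) / 2) : ℝ) : ℂ) ≠ 0 := by exact_mod_cast hne
  rw [Complex.ofReal_inv]
  rw [show ∀ A B D : ℂ, A⁻¹ * B * (A * D) = (A⁻¹ * A) * (B * D) by intros; ring,
    inv_mul_cancel₀ hne', one_mul, ← Complex.exp_add]
  congr 1
  have hv' : (v : ℂ) ≠ 0 := by exact_mod_cast hv.ne'
  push_cast
  rw [Complex.I_sq]
  field_simp
  ring

lemma integrable_gaussianDensity (m : E d) {v : ℝ} (hv : 0 < v) :
    Integrable (gaussianDensity m v) := by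
  have hb : 0 < ((1 / (2 * v) : ℝ) : ℂ).re := by
    rw [Complex.ofReal_re]; positivity
  have h := ((GaussianFourier.integrable_cexp_neg_mul_sq_norm_add hb 0 (0 : E d)).norm.comp_sub_right
    m).const_mul ((2 * Real.pi * v) ^ (-(d : ℝ) / 2))
  refine h.congr (Filter.Eventually.of_forall fun x => ?_)
  simp only [gaussianDensity, Complex.norm_exp]
  congr 2
  have : (-((1 / (2 * v) : ℝ) : ℂ) * (‖x - m‖ : ℂ) ^ 2 + 0 * ((⟪(0 : E d), x - m⟫ : ℝ) : ℂ)) =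
    ((-(‖x - m‖ ^ 2 / (2 * v)) : ℝ) : ℂ) := by push_cast; field_simp; ring
  rw [this, Complex.ofReal_re]

lemma map_stdGaussian_eq_withDensity (m : E d) {σ : ℝ} (hσ : 0 < σ) :
    (stdGaussian (E d)).map (fun z => m + σ • z) =
      volume.withDensity fun x => ENNReal.ofReal (gaussianDensity m (σ ^ 2) x) := by
  have hv : 0 < σ ^ 2 := by positivity
  have hm : Measurable (fun x : E d => gaussianDensity m (σ ^ 2) x) := by
    unfold gaussianDensity; fun_prop
  have : IsFiniteMeasure (volume.withDensity fun x : E d =>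
      ENNReal.ofReal (gaussianDensity m (σ ^ 2) x)) :=
    isFiniteMeasure_withDensity_ofReal (integrable_gaussianDensity m hv).2
  have : IsProbabilityMeasure ((stdGaussian (E d)).map (fun z => m + σ • z)) :=
    Measure.isProbabilityMeasure_map (by fun_prop)
  apply Measure.ext_of_charFun
  ext t
  rw [charFun_apply, charFun_apply, integral_map (by fun_prop) (by fun_prop),
    integral_withDensity_eq_integral_toReal_smul (by fun_prop) (by simp)]
  have h2 := charFun_stdGaussian (σ • t)
  rw [charFun_apply] at h2
  simp_rw [inner_add_left, Complex.ofReal_add, add_mul, Complex.exp_add, inner_smul_left]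
  simp_rw [inner_smul_right] at h2
  rw [integral_const_mul]
  simp only [RCLike.conj_to_real]
  rw [h2]
  have := integral_gaussianDensity_mul_cexp m hv t
  simp_rw [ENNReal.toReal_ofReal (gaussianDensity_nonneg m hv _), Complex.real_smul]
  rw [this, ← Complex.exp_add]
  congr 1
  rw [norm_smul]
  push_cast
  rw [mul_pow, ← Complex.ofReal_pow ‖σ‖, Real.norm_eq_abs, sq_abs]
  push_cast
  ring

lemma lintegral_stdGaussian_affine (m : E d) {v : ℝ} (hv : 0 < v) {f : E d → ℝ≥0∞}
    (hf : Measurable f) :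
    ∫⁻ z, f (m + Real.sqrt v • z) ∂(stdGaussian (E d)) =
      ∫⁻ x, ENNReal.ofReal (gaussianDensity m v x) * f x := by
  have h := map_stdGaussian_eq_withDensity m (Real.sqrt_pos.2 hv)
  rw [Real.sq_sqrt hv.le] at h
  have hg : Measurable (fun x : E d => gaussianDensity m v x) := by
    unfold gaussianDensity; fun_prop
  have hg' : Measurable (fun x : E d => ENNReal.ofReal (gaussianDensity m v x)) :=
    hg.ennreal_ofReal
  have hT : Measurable (fun z : E d => m + Real.sqrt v • z) := by fun_prop
  have h0 := lintegral_map (μ := stdGaussian (E d)) hf hT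
  have h2 := lintegral_withDensity_eq_lintegral_mul (volume : Measure (E d)) hg' hf
  rw [← h0, h, h2]
  simp only [Pi.mul_apply]

lemma ouLaw_eq_withDensity {p : E d → ℝ} (hp : IsProbDensity p) {t : ℝ} (ht : 0 < t) :
    ouLaw p t = volume.withDensity fun x => ENNReal.ofReal (ouDensity p t x) := by
  have hv : 0 < 1 - Real.exp (-2 * t) := by
    have : Real.exp (-2 * t) < 1 := by
      simpa using Real.exp_lt_exp.2 (show -2 * t < 0 by linarith)
    linarith
  have hσ := Real.sqrt_pos.2 hv
  have hpm := hp.measurable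
  have hpi : Integrable p := ⟨hpm.aestronglyMeasurable, by
    rw [hasFiniteIntegral_iff_ofReal (Filter.Eventually.of_forall hp.nonneg),
      hp.lintegral_eq_one]
    exact ENNReal.one_lt_top⟩
  have hgm := measurable_gaussianDensity_uncurry (d := d) (Real.exp (-t)) (1 - Real.exp (-2 * t))
  have : SFinite (densityMeasure p) := by unfold densityMeasure; infer_instance
  have hcont : ∀ x : E d, Integrable fun y => p y *
      gaussianDensity (Real.exp (-t) • y) (1 - Real.exp (-2 * t)) x := by
    intro x
    refine hpi.mul_bdd (c := (2 * Real.pi * (1 - Real.exp (-2 * t))) ^ (-(d : ℝ) / 2)) ?_ ?_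
    · exact (hgm.comp (measurable_id.prodMk measurable_const)).aestronglyMeasurable
    · refine Filter.Eventually.of_forall fun y => ?_
      rw [Real.norm_of_nonneg (gaussianDensity_nonneg _ hv _)]
      unfold gaussianDensity
      refine mul_le_of_le_one_right (by positivity) (Real.exp_le_one_iff.2 ?_)
      rw [neg_nonpos]; positivity
  refine Measure.ext_of_lintegral _ fun f hf => ?_
  unfold ouLaw
  rw [lintegral_map hf (by fun_prop), lintegral_prod _ (by fun_prop)]
  simp_rw [lintegral_stdGaussian_affine _ hv hf]
  have hod : ∀ x, ENNReal.ofReal (ouDensity p t x) = ∫⁻ y, ENNReal.ofReal (p y) *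
      ENNReal.ofReal (gaussianDensity (Real.exp (-t) • y) (1 - Real.exp (-2 * t)) x) := by
    intro x
    unfold ouDensity
    rw [ofReal_integral_eq_lintegral_ofReal (hcont x) (Filter.Eventually.of_forall fun y =>
      mul_nonneg (hp.nonneg y) (gaussianDensity_nonneg _ hv _))]
    simp_rw [ENNReal.ofReal_mul (hp.nonneg _)]
  have hF : Measurable fun w : E d × E d => ENNReal.ofReal (p w.1) *
      ENNReal.ofReal (gaussianDensity (Real.exp (-t) • w.1) (1 - Real.exp (-2 * t)) w.2) := by
    fun_prop
  have hG : Measurable fun w : E d × E d => ENNReal.ofReal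
      (gaussianDensity (Real.exp (-t) • w.1) (1 - Real.exp (-2 * t)) w.2) * f w.2 := by
    fun_prop
  unfold densityMeasure
  rw [lintegral_withDensity_eq_lintegral_mul _ (by fun_prop) hG.lintegral_prod_right',
    lintegral_withDensity_eq_lintegral_mul _ (by simp_rw [hod]; exact hF.lintegral_prod_left') hf]
  simp only [Pi.mul_apply, hod]
  simp_rw [← lintegral_const_mul' _ _ ENNReal.ofReal_ne_top]
  rw [lintegral_lintegral_swap (by
    exact (((hpm.comp measurable_fst).ennreal_ofReal).mul hG).aemeasurable)]
  refine lintegral_congr fun x => ?_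
  have hx : Measurable fun y : E d => ENNReal.ofReal (p y) *
      ENNReal.ofReal (gaussianDensity (Real.exp (-t) • y) (1 - Real.exp (-2 * t)) x) :=
    hF.comp (measurable_id.prodMk measurable_const)
  rw [← lintegral_mul_const _ hx]
  refine lintegral_congr fun y => ?_
  simp only [mul_assoc]

/-- The score `s(t, x) = ∇ log μ_t (x)`, where `μ_t` is the density of the Ornstein–Uhlenbeck
process at time `t`. -/
def score (p : E d → ℝ) (t : ℝ) (x : E d) : E d :=
  gradient (fun y => Real.log (ouDensity p t y)) x

/-- The largest (real) eigenvalue of an operator on `ℝ^d`. -/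
def lambdaMax (A : E d →L[ℝ] E d) : ℝ :=
  sSup {c : ℝ | Module.End.HasEigenvalue (A : E d →ₗ[ℝ] E d) c}

end OUScore

end

open OUScore

/-!
# One-sided Lipschitz bounds for Ornstein–Uhlenbeck scores

Write `m = exp (-t)` and `w = 1 - m ^ 2`. Up to factors that do not depend on `y`, the conditional
density of `Y_0` given `Y_t = x` is the posterior density
`p y * exp (-(m ^ 2 / (2 * w)) * ‖y‖ ^ 2 + m / w * ⟪x, y⟫)`. Along a line `s ↦ x + s • v` the
function `log μ_t` is a quadratic plus the cumulant generating function of `m / w * ⟪v, ·⟫` under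
the posterior, so its second derivative is `-‖v‖ ^ 2 / w + m ^ 2 / w ^ 2 * Var ⟪v, Y_0⟫`
(`iteratedDeriv_two_log_integral_gaussianDensity_le`). Both the eigenvalue bound and the one-sided
Lipschitz bound express an upper bound for these directional second derivatives, hence for the
posterior variances of linear functionals.

Apart from the factor `exp a`, the posterior is strongly log-concave with some curvature `τ⁻²`.
The Prékopa–Leindler inequality then bounds its Laplace transform `M` by
`M h * M (-h) ≤ exp (τ ^ 2 * ‖h‖ ^ 2) * M 0 ^ 2`
(`IsStronglyLogConcave.integral_mul_integral_le`). This gives the sharp variance bound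
`Var ⟪v, ·⟫ ≤ τ ^ 2 * ‖v‖ ^ 2`, by comparing second order terms at `h = 0`, and fourth moments of
order `τ ^ 4`. Since `a` is bounded and `β`-Hölder, and the posterior lives at scale `τ` around its
mean, restoring the factor `exp a` costs a factor `1 + O(τ ^ β)` in the variance
(`IsLaplaceSubgaussian.integral_inner_sq_mul_exp_le`).

For a Gaussian potential `τ ^ 2 = w`: the leading term cancels exactly and the error is
`O(m ^ 2 * w ^ (β / 2 - 1))`. For a ball potential `y ↦ u (‖y‖ ^ 2)` is convex, as `u` is convex and
nondecreasing, so that `τ ^ 2 = w / m ^ 2`, which is enough for `t ≤ 1`; for `t ≥ 1` the variance is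
at most `‖v‖ ^ 2`, because the posterior is supported in the unit ball.
-/

/-! ### The Prékopa–Leindler inequality -/

/-- The Brunn–Minkowski inequality on the line, for nonempty compact sets: the translates
`x + L` and `K + y` by the largest point `x` of `K` and the smallest point `y` of `L` overlap in at
most one point. -/
lemma volume_add_volume_le_of_isCompact {K L C : Set ℝ} (hK : IsCompact K) (hL : IsCompact L)
    (hK0 : K.Nonempty) (hL0 : L.Nonempty) (h : ∀ x ∈ K, ∀ y ∈ L, x + y ∈ C) :
    volume K + volume L ≤ volume C := by
  obtain ⟨x, hxK, hx⟩ := hK.exists_isGreatest hK0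
  obtain ⟨y, hyL, hy⟩ := hL.exists_isLeast hL0
  have h1 : volume ((fun z => z + (-y)) ⁻¹' K) = volume K := measure_preimage_add_right _ _ _
  have h2 : volume ((fun z => z + (-x)) ⁻¹' L) = volume L := measure_preimage_add_right _ _ _
  rw [← h1, ← h2, ← measure_union₀]
  · refine measure_mono ?_
    rintro z (hz | hz)
    · simpa using h _ hz y hyL
    · simpa using h x hxK _ hz
  · exact (hL.measurableSet.preimage (by fun_prop)).nullMeasurableSet
  · refine measure_mono_null (t := {x + y}) ?_ (by simp)
    rintro z ⟨hz1, hz2⟩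
    have := hx hz1
    have := hy hz2
    simp only [mem_singleton_iff]
    linarith

lemma measure_le_iSup_isCompact_nonempty {A : Set ℝ} (hA : MeasurableSet A) :
    volume A ≤ ⨆ (K : Set ℝ) (_ : K ⊆ A ∧ IsCompact K ∧ K.Nonempty), volume K := by
  rw [hA.measure_eq_iSup_isCompact]
  refine iSup₂_le fun K hKA => iSup_le fun hK => ?_
  rcases K.eq_empty_or_nonempty with rfl | h0
  · simp
  · exact le_iSup₂_of_le K ⟨hKA, hK, h0⟩ le_rfl

/-- The Brunn–Minkowski inequality on the line, for midpoints. -/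
lemma volume_add_volume_le_of_midpoint_mem {A B C : Set ℝ} (hA : MeasurableSet A)
    (hB : MeasurableSet B) (hA0 : A.Nonempty) (hB0 : B.Nonempty)
    (h : ∀ x ∈ A, ∀ y ∈ B, (x + y) / 2 ∈ C) :
    volume A + volume B ≤ 2 * volume C := by
  refine (add_le_add (measure_le_iSup_isCompact_nonempty hA)
    (measure_le_iSup_isCompact_nonempty hB)).trans ?_
  obtain ⟨x, hx⟩ := hA0
  obtain ⟨y, hy⟩ := hB0
  refine ENNReal.biSup_add_biSup_le' ⟨{x}, by simpa using hx⟩ ⟨{y}, by simpa using hy⟩ ?_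
  rintro K ⟨hKA, hK, hK0⟩ L ⟨hLB, hL, hL0⟩
  have hC : volume ((fun z => z * (1 / 2)) ⁻¹' C) = 2 * volume C := by
    rw [Real.volume_preimage_mul_right (by norm_num)]
    norm_num
  rw [← hC]
  refine volume_add_volume_le_of_isCompact hK hL hK0 hL0 fun a ha b hb => ?_
  have := h a (hKA ha) b (hLB hb)
  rwa [div_eq_mul_one_div] at this

lemma lintegral_eq_lintegral_meas_lt_of_ne_top {f : ℝ → ℝ≥0∞} (hf : Measurable f)
    (h : ∀ x, f x ≠ ∞) :
    ∫⁻ x, f x = ∫⁻ t in Ioi (0 : ℝ), volume {x | ENNReal.ofReal t < f x} := by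
  have := lintegral_eq_lintegral_meas_lt (volume : Measure ℝ) (f := fun x => (f x).toReal)
    (Filter.Eventually.of_forall fun x => ENNReal.toReal_nonneg) hf.ennreal_toReal.aemeasurable
  simp only [ENNReal.ofReal_toReal (h _)] at this
  rw [this]
  refine setLIntegral_congr_fun measurableSet_Ioi fun t ht => ?_
  simp only [ENNReal.ofReal_lt_iff_lt_toReal (le_of_lt ht) (h _)]

/-- The arithmetic form of the Prékopa–Leindler inequality on the line, for functions with
supremum `1`: the superlevel sets satisfy the Brunn–Minkowski inequality. -/
lemma lintegral_add_le_of_iSup_eq_one {f g h : ℝ → ℝ≥0∞} (hf : Measurable f) (hg : Measurable g)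
    (hh : Measurable h) (hf1 : ⨆ x, f x = 1) (hg1 : ⨆ x, g x = 1)
    (H : ∀ x y, f x * g y ≤ h ((x + y) / 2) ^ 2) :
    (∫⁻ x, f x) + ∫⁻ x, g x ≤ 2 * ∫⁻ x, h x := by
  have fle : ∀ x, f x ≤ 1 := fun x => hf1 ▸ le_iSup f x
  have gle : ∀ x, g x ≤ 1 := fun x => hg1 ▸ le_iSup g x
  have htop : ∀ a : ℝ≥0∞, a ≤ 1 → a ≠ ∞ := fun a ha => ne_top_of_le_ne_top ENNReal.one_ne_top ha
  -- truncating `h` at height `1` keeps the hypothesis, and makes the layer cake formula available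
  have hmin : ∫⁻ x, min (h x) 1 ≤ ∫⁻ x, h x := lintegral_mono fun x => min_le_left _ _
  refine le_trans ?_ (mul_le_mul_right hmin 2)
  have anti : ∀ k : ℝ → ℝ≥0∞, Measurable fun t : ℝ => volume {x | ENNReal.ofReal t < k x} := by
    intro k
    refine Antitone.measurable fun s t hst => measure_mono fun x hx => ?_
    exact (ENNReal.ofReal_le_ofReal hst).trans_lt hx
  rw [lintegral_eq_lintegral_meas_lt_of_ne_top hf fun x => htop _ (fle x),
    lintegral_eq_lintegral_meas_lt_of_ne_top hg fun x => htop _ (gle x),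
    lintegral_eq_lintegral_meas_lt_of_ne_top (hh.min measurable_const)
      fun x => htop _ (min_le_right _ _), ← lintegral_add_left (anti f),
    ← lintegral_const_mul _ (anti _)]
  refine setLIntegral_mono' measurableSet_Ioi fun t ht => ?_
  rcases lt_or_ge t 1 with h1 | h1
  · have ht1 : ENNReal.ofReal t < 1 := by simpa using h1
    refine volume_add_volume_le_of_midpoint_mem (measurableSet_lt measurable_const hf)
      (measurableSet_lt measurable_const hg) ?_ ?_ ?_
    · exact lt_iSup_iff.1 (hf1 ▸ ht1)
    · exact lt_iSup_iff.1 (hg1 ▸ ht1)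
    · intro x hx y hy
      refine lt_min ?_ ht1
      by_contra! hle
      have h2 : ENNReal.ofReal t * ENNReal.ofReal t < f x * g y := ENNReal.mul_lt_mul hx hy
      have h3 := h2.trans_le (H x y)
      rw [← sq] at h3
      exact absurd (pow_le_pow_left' hle 2) (not_le.2 h3)
  · have ht1 : (1 : ℝ≥0∞) ≤ ENNReal.ofReal t := by simpa using h1
    have e : ∀ k : ℝ → ℝ≥0∞, (∀ x, k x ≤ 1) → {x | ENNReal.ofReal t < k x} = ∅ := fun k hk =>
      eq_empty_of_forall_notMem fun x hx => absurd ((hk x).trans ht1) (not_le.2 hx)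
    rw [e f fle, e g gle]
    simp

lemma ENNReal.four_mul_le_sq_add (a b : ℝ≥0∞) : 4 * (a * b) ≤ (a + b) ^ 2 := by
  rcases eq_or_ne a ∞ with rfl | ha
  · simp
  rcases eq_or_ne b ∞ with rfl | hb
  · simp
  lift a to NNReal using ha
  lift b to NNReal using hb
  norm_cast
  have := _root_.four_mul_le_sq_add (a : ℝ) b
  rw [← NNReal.coe_le_coe]
  push_cast
  linarith

lemma prekopa_leindler_real_of_bounded {f g h : ℝ → ℝ≥0∞} (hf : Measurable f)
    (hg : Measurable g) (hh : Measurable h) (hf1 : ⨆ x, f x ≠ ∞) (hg1 : ⨆ x, g x ≠ ∞)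
    (H : ∀ x y, f x * g y ≤ h ((x + y) / 2) ^ 2) :
    (∫⁻ x, f x) * ∫⁻ x, g x ≤ (∫⁻ x, h x) ^ 2 := by
  rcases eq_or_ne (⨆ x, f x) 0 with hf0 | hf0
  · simp [ENNReal.iSup_eq_zero.1 hf0]
  rcases eq_or_ne (⨆ x, g x) 0 with hg0 | hg0
  · simp [ENNReal.iSup_eq_zero.1 hg0]
  set M := ⨆ x, f x
  set N := ⨆ x, g x
  -- the scaling of `h` that matches the normalizations `f / M` and `g / N` of the suprema
  set c : ℝ≥0∞ := (M⁻¹ * N⁻¹) ^ (1 / 2 : ℝ) with hc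
  have hc2 : c ^ 2 = M⁻¹ * N⁻¹ := by
    rw [hc, ← ENNReal.rpow_natCast, ← ENNReal.rpow_mul]; norm_num
  have key := lintegral_add_le_of_iSup_eq_one (f := fun x => M⁻¹ * f x) (g := fun x => N⁻¹ * g x)
    (h := fun x => c * h x) (hf.const_mul _) (hg.const_mul _) (hh.const_mul _)
    (by rw [← ENNReal.mul_iSup]; exact ENNReal.inv_mul_cancel hf0 hf1)
    (by rw [← ENNReal.mul_iSup]; exact ENNReal.inv_mul_cancel hg0 hg1)
    (fun x y => by
      rw [mul_pow, hc2, mul_mul_mul_comm]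
      exact mul_le_mul_right (H x y) _)
  rw [lintegral_const_mul _ hf, lintegral_const_mul _ hg, lintegral_const_mul _ hh] at key
  have h4 := (ENNReal.four_mul_le_sq_add _ _).trans (pow_le_pow_left' key 2)
  rw [mul_pow, mul_pow, hc2, mul_mul_mul_comm, show (2 : ℝ≥0∞) ^ 2 = 4 by norm_num,
    ENNReal.mul_le_mul_iff_right (by norm_num) (by norm_num)] at h4
  rwa [ENNReal.mul_le_mul_iff_right] at h4
  · simp [hf1, hg1]
  · exact ENNReal.mul_ne_top (by simpa using hf0) (by simpa using hg0)

lemma lintegral_eq_iSup_lintegral_min {f : ℝ → ℝ≥0∞} (hf : Measurable f) :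
    ∫⁻ x, f x = ⨆ n : ℕ, ∫⁻ x, min (f x) n := by
  rw [← lintegral_iSup (fun n => hf.min measurable_const)]
  · refine lintegral_congr fun x => ?_
    rw [← inf_iSup_eq, ENNReal.iSup_natCast, inf_top_eq]
  · exact fun m n hmn x => min_le_min le_rfl (by exact_mod_cast hmn)

/-- The Prékopa–Leindler inequality on the line. -/
lemma prekopa_leindler_real {f g h : ℝ → ℝ≥0∞} (hf : Measurable f) (hg : Measurable g)
    (hh : Measurable h) (H : ∀ x y, f x * g y ≤ h ((x + y) / 2) ^ 2) :
    (∫⁻ x, f x) * ∫⁻ x, g x ≤ (∫⁻ x, h x) ^ 2 := by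
  rw [lintegral_eq_iSup_lintegral_min hf, lintegral_eq_iSup_lintegral_min hg, ENNReal.iSup_mul]
  refine iSup_le fun m => ?_
  rw [ENNReal.mul_iSup]
  refine iSup_le fun n => ?_
  have b : ∀ (k : ℝ → ℝ≥0∞) (n : ℕ), ⨆ x, min (k x) n ≠ ∞ := fun k n =>
    ne_top_of_le_ne_top (ENNReal.natCast_ne_top n) (iSup_le fun x => min_le_right _ _)
  exact prekopa_leindler_real_of_bounded (hf.min measurable_const) (hg.min measurable_const) hh
    (b f m) (b g n) fun x y =>
      (mul_le_mul' (min_le_left _ _) (min_le_left _ _)).trans (H x y)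

lemma lintegral_finSucc {n : ℕ} {f : (Fin (n + 1) → ℝ) → ℝ≥0∞} (hf : Measurable f) :
    ∫⁻ x, f x = ∫⁻ s : ℝ, ∫⁻ y : Fin n → ℝ, f (Fin.cons s y) := by
  have hp := (volume_preserving_piFinSuccAbove (fun _ : Fin (n + 1) => ℝ) 0).symm
  rw [← hp.lintegral_comp hf, Measure.volume_eq_prod, lintegral_prod]
  · simp [MeasurableEquiv.piFinSuccAbove, Fin.insertNthEquiv]
  · exact (hf.comp (MeasurableEquiv.measurable _)).aemeasurable

/-- The Prékopa–Leindler inequality on `ℝⁿ`, by induction on the dimension: the marginals satisfy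
the hypothesis of the inequality on the line. -/
lemma prekopa_leindler_pi {n : ℕ} {f g h : (Fin n → ℝ) → ℝ≥0∞} (hf : Measurable f)
    (hg : Measurable g) (hh : Measurable h)
    (H : ∀ x y, f x * g y ≤ h ((2 : ℝ)⁻¹ • (x + y)) ^ 2) :
    (∫⁻ x, f x) * ∫⁻ x, g x ≤ (∫⁻ x, h x) ^ 2 := by
  induction n with
  | zero =>
    have h0 : volume (univ : Set (Fin 0 → ℝ)) = 1 := by simp [volume_pi]
    rw [lintegral_unique, lintegral_unique, lintegral_unique, h0, mul_one, mul_one, mul_one]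
    convert H default default
  | succ n ih =>
    have hcons : Measurable fun w : ℝ × (Fin n → ℝ) => (Fin.cons w.1 w.2 : Fin (n + 1) → ℝ) := by
      refine measurable_pi_lambda _ fun i => ?_
      refine Fin.cases ?_ (fun j => ?_) i
      · simpa using measurable_fst
      · simp only [Fin.cons_succ]
        fun_prop
    rw [lintegral_finSucc hf, lintegral_finSucc hg, lintegral_finSucc hh]
    refine prekopa_leindler_real (hf.comp hcons).lintegral_prod_right'
      (hg.comp hcons).lintegral_prod_right' (hh.comp hcons).lintegral_prod_right' fun s t => ?_
    refine ih (hf.comp (hcons.comp measurable_prodMk_left))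
      (hg.comp (hcons.comp measurable_prodMk_left))
      (hh.comp (hcons.comp measurable_prodMk_left)) fun x y => ?_
    refine (H _ _).trans_eq ?_
    congr 2
    ext i
    refine Fin.cases ?_ (fun j => ?_) i
    · simp [div_eq_inv_mul]
    · simp [mul_add]

lemma prekopa_leindler {d : ℕ} {f g h : E d → ℝ≥0∞} (hf : Measurable f) (hg : Measurable g)
    (hh : Measurable h) (H : ∀ x y, f x * g y ≤ h (midpoint ℝ x y) ^ 2) :
    (∫⁻ x, f x) * ∫⁻ x, g x ≤ (∫⁻ x, h x) ^ 2 := by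
  have hp := PiLp.volume_preserving_toLp (Fin d)
  have hm : Measurable (WithLp.toLp 2 : (Fin d → ℝ) → E d) := hp.measurable
  rw [← hp.lintegral_comp hf, ← hp.lintegral_comp hg, ← hp.lintegral_comp hh]
  refine prekopa_leindler_pi (hf.comp hm) (hg.comp hm) (hh.comp hm) fun x y => ?_
  refine (H _ _).trans_eq ?_
  rw [midpoint_eq_smul_add]
  simp

/-! ### Moments of measures with a Gaussian bound on the Laplace transform -/

lemma Real.one_add_sq_div_two_le_cosh (x : ℝ) : 1 + x ^ 2 / 2 ≤ Real.cosh x := by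
  wlog hx : 0 ≤ x generalizing x
  · simpa using this (-x) (by linarith)
  have h1 : x / 2 ≤ Real.sinh (x / 2) := Real.self_le_sinh_iff.2 (by linarith)
  have h2 := Real.cosh_two_mul (x / 2)
  have h3 := Real.cosh_sq (x / 2)
  rw [show 2 * (x / 2) = x by ring] at h2
  nlinarith

lemma Real.pow_four_le_exp_add_exp_neg (x : ℝ) : x ^ 4 ≤ 24 * (Real.exp x + Real.exp (-x)) := by
  have h := Real.pow_div_factorial_le_exp |x| (abs_nonneg x) 4
  have h2 : Real.exp |x| ≤ Real.exp x + Real.exp (-x) := by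
    rcases abs_cases x with ⟨h, _⟩ | ⟨h, _⟩ <;> rw [h] <;>
      linarith [Real.exp_pos x, Real.exp_pos (-x)]
  rw [Even.pow_abs (by decide)] at h
  norm_num [Nat.factorial] at h
  linarith

lemma le_of_forall_one_add_sq_mul_le_exp {V A : ℝ}
    (h : ∀ s : ℝ, 1 + s ^ 2 * V ≤ Real.exp (s ^ 2 * A)) : V ≤ A := by
  -- compare the derivatives at `u = 0` of both sides in the variable `u = s ^ 2`
  have h' : ∀ u : ℝ, 0 ≤ u → 1 + u * V ≤ Real.exp (u * A) := fun u hu => by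
    simpa [Real.sq_sqrt hu] using h (Real.sqrt u)
  have hd : HasDerivWithinAt (fun u : ℝ => Real.exp (u * A) - (1 + u * V)) (A - V) (Ici 0) 0 := by
    have h1 : HasDerivAt (fun u : ℝ => Real.exp (u * A)) A 0 := by
      simpa using ((hasDerivAt_id (0 : ℝ)).mul_const A).exp
    have h2 : HasDerivAt (fun u : ℝ => 1 + u * V) V 0 := by
      simpa using ((hasDerivAt_id (0 : ℝ)).mul_const V).const_add 1
    exact (h1.sub h2).hasDerivWithinAt
  by_contra! hlt
  have hs := hasDerivWithinAt_iff_tendsto_slope.1 hd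
  rw [show Ici (0 : ℝ) \ {0} = Ioi 0 by ext; simp [lt_iff_le_and_ne, eq_comm]] at hs
  refine absurd (ge_of_tendsto hs ?_) (not_le.2 (sub_neg.2 hlt))
  filter_upwards [self_mem_nhdsWithin] with u hu
  have hu : 0 < u := hu
  rw [slope_def_field]
  refine div_nonneg ?_ (by linarith)
  simp only [zero_mul, Real.exp_zero, add_zero, sub_self, sub_zero]
  linarith [h' u hu.le]

/-- A centred random variable whose moment generating function `M` satisfies
`M s * M (-s) ≤ exp (s ^ 2 * A)` has variance at most `A`. With an independent copy `X'`, the left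
side is `𝔼 cosh (s (X - X')) ≥ 1 + s ^ 2 * Var X`. -/
lemma integral_sq_le_of_mgf_mul_mgf_neg_le {Ω : Type*} [MeasurableSpace Ω] {μ : Measure Ω}
    [IsProbabilityMeasure μ] {X : Ω → ℝ}
    (hexp : ∀ s : ℝ, Integrable (fun ω => Real.exp (s * X ω)) μ)
    (h0 : ∫ ω, X ω ∂μ = 0) {A : ℝ} (h : ∀ s, mgf X μ s * mgf X μ (-s) ≤ Real.exp (s ^ 2 * A)) :
    ∫ ω, X ω ^ 2 ∂μ ≤ A := by
  have hi1 : Integrable X μ := by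
    simpa using integrable_pow_of_integrable_exp_mul one_ne_zero (hexp 1) (hexp (-1)) 1
  have hi2 : Integrable (fun ω => X ω ^ 2) μ :=
    integrable_pow_of_integrable_exp_mul one_ne_zero (hexp 1) (hexp (-1)) 2
  refine le_of_forall_one_add_sq_mul_le_exp fun s => le_trans ?_ (h s)
  have hA : ∫ z : Ω × Ω, Real.exp (s * X z.1) * Real.exp (-s * X z.2) ∂(μ.prod μ) =
      mgf X μ s * mgf X μ (-s) :=
    integral_prod_mul (fun ω => Real.exp (s * X ω)) fun ω => Real.exp (-s * X ω)
  have hB : ∫ z : Ω × Ω, Real.exp (-s * X z.1) * Real.exp (s * X z.2) ∂(μ.prod μ) =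
      mgf X μ s * mgf X μ (-s) := by
    rw [mul_comm]
    exact integral_prod_mul (fun ω => Real.exp (-s * X ω)) fun ω => Real.exp (s * X ω)
  have iA := (hexp s).mul_prod (hexp (-s))
  have iB := (hexp (-s)).mul_prod (hexp s)
  have i1 : Integrable (fun z : Ω × Ω => X z.1 ^ 2) (μ.prod μ) := hi2.comp_fst μ
  have i2 : Integrable (fun z : Ω × Ω => X z.2 ^ 2) (μ.prod μ) := hi2.comp_snd μ
  have i3 : Integrable (fun z : Ω × Ω => X z.1 * X z.2) (μ.prod μ) := hi1.mul_prod hi1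
  have e1 : ∫ z : Ω × Ω, X z.1 ^ 2 ∂(μ.prod μ) = ∫ ω, X ω ^ 2 ∂μ := by
    simpa using integral_prod_mul (μ := μ) (ν := μ) (fun ω => X ω ^ 2) fun _ => (1 : ℝ)
  have e2 : ∫ z : Ω × Ω, X z.2 ^ 2 ∂(μ.prod μ) = ∫ ω, X ω ^ 2 ∂μ := by
    simpa using integral_prod_mul (μ := μ) (ν := μ) (fun _ => (1 : ℝ)) fun ω => X ω ^ 2
  have e3 : ∫ z : Ω × Ω, X z.1 * X z.2 ∂(μ.prod μ) = 0 := by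
    rw [integral_prod_mul, h0, zero_mul]
  have hL : ∫ z : Ω × Ω, (1 + s ^ 2 / 2 * (X z.1 ^ 2 + X z.2 ^ 2 - 2 * (X z.1 * X z.2)))
      ∂(μ.prod μ) = 1 + s ^ 2 * ∫ ω, X ω ^ 2 ∂μ := by
    have i12 : Integrable (fun z : Ω × Ω => X z.1 ^ 2 + X z.2 ^ 2) (μ.prod μ) := i1.add i2
    have i33 : Integrable (fun z : Ω × Ω => 2 * (X z.1 * X z.2)) (μ.prod μ) := i3.const_mul 2
    have i123 : Integrable (fun z : Ω × Ω => X z.1 ^ 2 + X z.2 ^ 2 - 2 * (X z.1 * X z.2))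
      (μ.prod μ) := i12.sub i33
    rw [integral_add (integrable_const _) (i123.const_mul _), integral_const_mul,
      integral_sub i12 i33, integral_add i1 i2, integral_const_mul, e1, e2, e3]
    simp
    ring
  have hR : ∫ z : Ω × Ω, (Real.exp (s * X z.1) * Real.exp (-s * X z.2) +
      Real.exp (-s * X z.1) * Real.exp (s * X z.2)) / 2 ∂(μ.prod μ) =
      mgf X μ s * mgf X μ (-s) := by
    rw [integral_div, integral_add iA iB, hA, hB]; ring
  rw [← hL, ← hR]
  refine integral_mono ((integrable_const _).add (((i1.add i2).sub (i3.const_mul 2)).const_mul _))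
    ((iA.add iB).div_const 2) fun z => ?_
  have := Real.one_add_sq_div_two_le_cosh (s * (X z.1 - X z.2))
  rw [Real.cosh_eq] at this
  simp only [← Real.exp_add]
  rw [show s * X z.1 + -s * X z.2 = s * (X z.1 - X z.2) by ring,
    show -s * X z.1 + s * X z.2 = -(s * (X z.1 - X z.2)) by ring]
  refine le_trans (le_of_eq ?_) this
  ring

variable {d : ℕ}

lemma norm_pow_four_le_sum (y : E d) : ‖y‖ ^ 4 ≤ d * ∑ i, y i ^ 4 := by
  rw [show ‖y‖ ^ 4 = (‖y‖ ^ 2) ^ 2 by ring, EuclideanSpace.real_norm_sq_eq]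
  have := sq_sum_le_card_mul_sum_sq (s := Finset.univ) (f := fun i : Fin d => y i ^ 2)
  simp only [← pow_mul] at this
  simpa using this

/-- A probability measure on `ℝ^d` with finite exponential moments whose Laplace transform `M`
satisfies `M h * M (-h) ≤ exp (τ ^ 2 * ‖h‖ ^ 2)`. Gaussian measures of covariance `τ ^ 2 Id` attain
equality. -/
structure IsLaplaceSubgaussian (τ : ℝ) (Q : Measure (E d)) : Prop where
  isProbabilityMeasure : IsProbabilityMeasure Q
  integrable_exp : ∀ h : E d, Integrable (fun y => Real.exp ⟪h, y⟫) Q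
  laplace_mul_le : ∀ h : E d, (∫ y, Real.exp ⟪h, y⟫ ∂Q) * (∫ y, Real.exp ⟪-h, y⟫ ∂Q) ≤
    Real.exp (τ ^ 2 * ‖h‖ ^ 2)

namespace IsLaplaceSubgaussian

variable {τ : ℝ} {Q : Measure (E d)}

lemma integrable_inner_pow (hQ : IsLaplaceSubgaussian τ Q) (h : E d) (n : ℕ) :
    Integrable (fun y => ⟪h, y⟫ ^ n) Q :=
  integrable_pow_of_integrable_exp_mul (t := 1) one_ne_zero
    (by simpa using hQ.integrable_exp h) (by simpa using hQ.integrable_exp (-h)) n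

lemma integrable_norm_pow_four (hQ : IsLaplaceSubgaussian τ Q) :
    Integrable (fun y => ‖y‖ ^ 4) Q := by
  have h : Integrable (fun y : E d => (d : ℝ) * ∑ i, y i ^ 4) Q := by
    refine (integrable_finsetSum _ fun i _ => ?_).const_mul _
    simpa [EuclideanSpace.inner_single_left] using
      hQ.integrable_inner_pow (EuclideanSpace.single i (1 : ℝ)) 4
  refine h.mono' (by fun_prop) (Filter.Eventually.of_forall fun y => ?_)
  rw [Real.norm_of_nonneg (by positivity)]
  exact norm_pow_four_le_sum y

lemma integrable_id (hQ : IsLaplaceSubgaussian τ Q) : Integrable (fun y : E d => y) Q := by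
  have := hQ.isProbabilityMeasure
  refine ((integrable_const (1 : ℝ)).add hQ.integrable_norm_pow_four).mono' (by fun_prop)
    (Filter.Eventually.of_forall fun y => ?_)
  simp only [Pi.add_apply]
  nlinarith [sq_nonneg (‖y‖ ^ 2 - 1), sq_nonneg (‖y‖ - 1), norm_nonneg y]

/-- The translate of `Q` to mean zero. -/
lemma map_sub_mean (hQ : IsLaplaceSubgaussian τ Q) :
    IsLaplaceSubgaussian τ (Q.map fun y => y - ∫ z, z ∂Q) := by
  have := hQ.isProbabilityMeasure
  set c := ∫ z, z ∂Q
  have e : ∀ h y : E d, Real.exp ⟪h, y - c⟫ = Real.exp (-⟪h, c⟫) * Real.exp ⟪h, y⟫ := by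
    intro h y
    rw [inner_sub_right, ← Real.exp_add]; ring_nf
  refine ⟨Measure.isProbabilityMeasure_map (by fun_prop), fun h => ?_, fun h => ?_⟩
  · rw [integrable_map_measure (by fun_prop) (by fun_prop)]
    simp only [Function.comp_def, e]
    exact (hQ.integrable_exp h).const_mul _
  · rw [integral_map (by fun_prop) (by fun_prop), integral_map (by fun_prop) (by fun_prop)]
    simp only [e, integral_const_mul, inner_neg_left h c]
    rw [mul_mul_mul_comm, ← Real.exp_add]
    simpa using hQ.laplace_mul_le h

lemma integral_map_sub_mean (hQ : IsLaplaceSubgaussian τ Q) :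
    ∫ y, y ∂(Q.map fun y => y - ∫ z, z ∂Q) = 0 := by
  have := hQ.isProbabilityMeasure
  rw [integral_map (by fun_prop) (by fun_prop), integral_sub hQ.integrable_id (integrable_const _)]
  simp

lemma integral_inner_eq_zero (hQ : IsLaplaceSubgaussian τ Q) (h0 : ∫ y, y ∂Q = 0) (v : E d) :
    ∫ y, ⟪v, y⟫ ∂Q = 0 := by
  rw [integral_inner hQ.integrable_id, h0, inner_zero_right]

lemma integral_inner_sq_le (hQ : IsLaplaceSubgaussian τ Q) (h0 : ∫ y, y ∂Q = 0) (v : E d) :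
    ∫ y, ⟪v, y⟫ ^ 2 ∂Q ≤ ‖v‖ ^ 2 * τ ^ 2 := by
  have := hQ.isProbabilityMeasure
  refine integral_sq_le_of_mgf_mul_mgf_neg_le (fun s => ?_) (hQ.integral_inner_eq_zero h0 v)
    fun s => ?_
  · simpa [inner_smul_left] using hQ.integrable_exp (s • v)
  · have := hQ.laplace_mul_le (s • v)
    simp only [mgf]
    simp only [inner_neg_left, inner_smul_left, norm_smul, mul_pow, Real.norm_eq_abs, sq_abs,
      conj_trivial] at this
    simp only [neg_mul]
    convert this using 2
    ring

/-- By Jensen's inequality both factors in `M h * M (-h)` are at least one when the mean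
vanishes. -/
lemma integral_exp_inner_le (hQ : IsLaplaceSubgaussian τ Q) (h0 : ∫ y, y ∂Q = 0) (h : E d) :
    ∫ y, Real.exp ⟪h, y⟫ ∂Q ≤ Real.exp (τ ^ 2 * ‖h‖ ^ 2) := by
  have := hQ.isProbabilityMeasure
  refine le_trans ?_ (hQ.laplace_mul_le h)
  have h1 : 1 ≤ ∫ y, Real.exp ⟪-h, y⟫ ∂Q := by
    have hi : Integrable (fun y => ⟪-h, y⟫) Q := by simpa using hQ.integrable_inner_pow (-h) 1
    have : ∫ y, (⟪-h, y⟫ + 1) ∂Q = 1 := by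
      rw [integral_add hi (integrable_const _), hQ.integral_inner_eq_zero h0]; simp
    rw [← this]
    exact integral_mono (hi.add (integrable_const _)) (hQ.integrable_exp _)
      fun y => Real.add_one_le_exp _
  exact le_mul_of_one_le_right (integral_nonneg fun y => (Real.exp_pos _).le) h1

lemma integral_norm_pow_four_le (hQ : IsLaplaceSubgaussian τ Q) (h0 : ∫ y, y ∂Q = 0)
    (hτ : 0 < τ) : ∫ y, ‖y‖ ^ 4 ∂Q ≤ 144 * d ^ 2 * τ ^ 4 := by
  have hi : ∀ i : Fin d, Integrable (fun y : E d => y i ^ 4) Q := fun i => by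
    simpa [EuclideanSpace.inner_single_left] using
      hQ.integrable_inner_pow (EuclideanSpace.single i (1 : ℝ)) 4
  have hc : ∀ i : Fin d, ∫ y : E d, y i ^ 4 ∂Q ≤ 144 * τ ^ 4 := by
    intro i
    -- the exponential moment at `τ⁻¹ eᵢ` controls the fourth moment of the coordinate
    set h : E d := EuclideanSpace.single i τ⁻¹ with hh
    have hn : τ ^ 2 * ‖h‖ ^ 2 = 1 := by
      rw [hh, PiLp.norm_single, Real.norm_eq_abs, sq_abs]; field_simp
    have b1 := hQ.integral_exp_inner_le h0 h
    have b2 := hQ.integral_exp_inner_le h0 (-h)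
    rw [norm_neg, hn] at b2
    rw [hn] at b1
    have hm := integral_mono (hQ.integrable_inner_pow h 4)
      (((hQ.integrable_exp h).add (hQ.integrable_exp (-h))).const_mul 24)
      (fun y => by simpa using Real.pow_four_le_exp_add_exp_neg ⟪h, y⟫)
    simp only [Pi.add_apply] at hm
    rw [integral_const_mul, integral_add (hQ.integrable_exp h) (hQ.integrable_exp (-h))] at hm
    have hin : ∀ y : E d, ⟪h, y⟫ ^ 4 = (τ ^ 4)⁻¹ * y i ^ 4 := fun y => by
      rw [hh, EuclideanSpace.inner_single_left, conj_trivial, mul_pow, inv_pow]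
    simp only [hin, integral_const_mul] at hm
    have he : Real.exp 1 ≤ 3 := Real.exp_one_lt_d9.le.trans (by norm_num)
    have hle : (τ ^ 4)⁻¹ * ∫ y : E d, y i ^ 4 ∂Q ≤ 144 := by linarith
    rwa [inv_mul_le_iff₀ (by positivity), mul_comm] at hle
  calc ∫ y, ‖y‖ ^ 4 ∂Q ≤ ∫ y : E d, (d : ℝ) * ∑ i, y i ^ 4 ∂Q := by
        refine integral_mono hQ.integrable_norm_pow_four
          ((integrable_finsetSum _ fun i _ => hi i).const_mul _) fun y => ?_
        exact norm_pow_four_le_sum y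
    _ = d * ∑ i : Fin d, ∫ y : E d, y i ^ 4 ∂Q := by
        rw [integral_const_mul, integral_finsetSum _ fun i _ => hi i]
    _ ≤ d * ∑ i : Fin d, 144 * τ ^ 4 := by gcongr with i; exact hc i
    _ = _ := by simp; ring

end IsLaplaceSubgaussian

/-! ### Bounded Hölder perturbations -/

lemma abs_exp_sub_one_le {b B : ℝ} (hb : |b| ≤ B) : |Real.exp b - 1| ≤ Real.exp B * |b| := by
  have hB := (abs_le.1 hb).2
  rw [abs_le]
  constructor
  · have h1 := Real.add_one_le_exp b
    have h2 : (1 : ℝ) ≤ Real.exp B := Real.one_le_exp ((abs_nonneg b).trans hb)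
    nlinarith [neg_abs_le b, abs_nonneg b]
  · have h1 := Real.add_one_le_exp (-b)
    have h2 : Real.exp b * Real.exp (-b) = 1 := by rw [← Real.exp_add]; simp
    have h3 : Real.exp b ≤ Real.exp B := Real.exp_le_exp.2 hB
    nlinarith [le_abs_self b, abs_nonneg b, Real.exp_pos b]

lemma rpow_le_mul_one_add_sq {r τ β : ℝ} (hr : 0 ≤ r) (hτ : 0 < τ) (hβ0 : 0 < β) (hβ1 : β ≤ 1) :
    r ^ β ≤ τ ^ β * (1 + (r / τ) ^ 2) := by
  have hρ : 0 ≤ r / τ := by positivity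
  have h : (r / τ) ^ β ≤ 1 + (r / τ) ^ 2 := by
    rcases le_total (r / τ) 1 with h1 | h1
    · have := Real.rpow_le_one hρ h1 hβ0.le
      nlinarith [sq_nonneg (r / τ)]
    · have := Real.rpow_le_rpow_of_exponent_le h1 hβ1
      rw [Real.rpow_one] at this
      nlinarith [sq_nonneg (r / τ)]
  calc r ^ β = τ ^ β * (r / τ) ^ β := by
        rw [← Real.mul_rpow hτ.le hρ, mul_div_cancel₀ _ hτ.ne']
    _ ≤ _ := by gcongr

/-- The constant in the variance bound for a perturbation `exp b`, where `|b| ≤ B` and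
`|b y| ≤ H * ‖y‖ ^ β`. -/
noncomputable def tiltConst (d : ℕ) (B H : ℝ) : ℝ := Real.exp (2 * B) * H * (2 * (1 + 144 * d ^ 2))

lemma tiltConst_nonneg {B H : ℝ} (hH : 0 ≤ H) : 0 ≤ tiltConst d B H := by
  unfold tiltConst; positivity

lemma inner_sq_sub_mul_exp_sub_one_le {τ B H β V b : ℝ} (hτ : 0 < τ) (hH : 0 ≤ H) (hβ0 : 0 < β)
    (hβ1 : β ≤ 1) {v y : E d} (hV0 : 0 ≤ V) (hV : V ≤ ‖v‖ ^ 2 * τ ^ 2) (hbB : |b| ≤ B)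
    (hbH : |b| ≤ H * ‖y‖ ^ β) :
    (⟪v, y⟫ ^ 2 - V) * (Real.exp b - 1) ≤
      ‖v‖ ^ 2 * τ ^ 2 * (Real.exp B * H * τ ^ β) * (2 * (1 + ‖y‖ ^ 4 / τ ^ 4)) := by
  set ρ := ‖y‖ / τ with hρ
  have hy : ‖y‖ = τ * ρ := by rw [hρ]; field_simp
  have hρ4 : ‖y‖ ^ 4 / τ ^ 4 = ρ ^ 4 := by rw [hρ, div_pow]
  have h1 : |Real.exp b - 1| ≤ Real.exp B * H * τ ^ β * (1 + ρ ^ 2) := by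
    calc _ ≤ Real.exp B * |b| := abs_exp_sub_one_le hbB
      _ ≤ Real.exp B * (H * (τ ^ β * (1 + ρ ^ 2))) := by
        gcongr
        exact hbH.trans
          (mul_le_mul_of_nonneg_left (rpow_le_mul_one_add_sq (norm_nonneg y) hτ hβ0 hβ1) hH)
      _ = _ := by ring
  have h2 : ⟪v, y⟫ ^ 2 ≤ ‖v‖ ^ 2 * τ ^ 2 * ρ ^ 2 := by
    have := pow_le_pow_left₀ (abs_nonneg _) (abs_real_inner_le_norm v y) 2
    rw [sq_abs, hy] at this
    linarith [this, show (‖v‖ * (τ * ρ)) ^ 2 = ‖v‖ ^ 2 * τ ^ 2 * ρ ^ 2 by ring]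
  have h3 : |⟪v, y⟫ ^ 2 - V| ≤ ‖v‖ ^ 2 * τ ^ 2 * (1 + ρ ^ 2) := by
    have h4 : 0 ≤ ‖v‖ ^ 2 * τ ^ 2 := by positivity
    have h5 : 0 ≤ ‖v‖ ^ 2 * τ ^ 2 * ρ ^ 2 := by positivity
    rw [abs_le, mul_add, mul_one]
    constructor <;> linarith [sq_nonneg ⟪v, y⟫]
  calc _ ≤ |⟪v, y⟫ ^ 2 - V| * |Real.exp b - 1| := by
        rw [← abs_mul]; exact le_abs_self _
    _ ≤ (‖v‖ ^ 2 * τ ^ 2 * (1 + ρ ^ 2)) * (Real.exp B * H * τ ^ β * (1 + ρ ^ 2)) := by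
      gcongr
    _ = ‖v‖ ^ 2 * τ ^ 2 * (Real.exp B * H * τ ^ β) * (1 + ρ ^ 2) ^ 2 := by ring
    _ ≤ _ := by
      rw [hρ4]
      gcongr
      nlinarith [sq_nonneg (ρ ^ 2 - 1)]

/-- A bounded perturbation `exp b` of a centred measure, Hölder at the mean, changes the variance
`V` of a linear functional `T = ⟪v, ·⟫` by a factor `1 + O(τ ^ β)` only, because
`𝔼 [(T ^ 2 - V) * exp b] = 𝔼 [(T ^ 2 - V) * (exp b - 1)]`. -/
lemma IsLaplaceSubgaussian.integral_inner_sq_mul_exp_le {τ : ℝ} {Q : Measure (E d)}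
    (hQ : IsLaplaceSubgaussian τ Q) (h0 : ∫ y, y ∂Q = 0) (hτ : 0 < τ) {b : E d → ℝ}
    (hbm : Measurable b) {B H β : ℝ} (hH : 0 ≤ H) (hβ0 : 0 < β) (hβ1 : β ≤ 1)
    (hbB : ∀ y, |b y| ≤ B) (hbH : ∀ y, |b y| ≤ H * ‖y‖ ^ β) (v : E d) :
    ∫ y, ⟪v, y⟫ ^ 2 * Real.exp (b y) ∂Q ≤
      ‖v‖ ^ 2 * τ ^ 2 * (1 + tiltConst d B H * τ ^ β) * ∫ y, Real.exp (b y) ∂Q := by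
  have := hQ.isProbabilityMeasure
  set V := ∫ y, ⟪v, y⟫ ^ 2 ∂Q with hV
  have hVle : V ≤ ‖v‖ ^ 2 * τ ^ 2 := hQ.integral_inner_sq_le h0 v
  have hV0 : 0 ≤ V := integral_nonneg fun y => sq_nonneg _
  have hexpB : ∀ y, ‖Real.exp (b y)‖ ≤ Real.exp B := fun y => by
    rw [Real.norm_of_nonneg (Real.exp_pos _).le]
    exact Real.exp_le_exp.2 (abs_le.1 (hbB y)).2
  have hem : AEStronglyMeasurable (fun y => Real.exp (b y)) Q := by fun_prop
  have hi2 := hQ.integrable_inner_pow v 2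
  have hie : Integrable (fun y => Real.exp (b y)) Q :=
    (integrable_const (Real.exp B)).mono' hem (Filter.Eventually.of_forall hexpB)
  have hiTe : Integrable (fun y => ⟪v, y⟫ ^ 2 * Real.exp (b y)) Q :=
    hi2.mul_bdd hem (Filter.Eventually.of_forall hexpB)
  set A := ‖v‖ ^ 2 * τ ^ 2 * (Real.exp B * H * τ ^ β) with hA
  have hA0 : 0 ≤ A := by positivity
  set D := A * (2 * (1 + 144 * d ^ 2)) with hD
  have hi4 := hQ.integrable_norm_pow_four
  have hdev :
      ∫ y, (⟪v, y⟫ ^ 2 * Real.exp (b y) - V * Real.exp (b y) - (⟪v, y⟫ ^ 2 - V)) ∂Q ≤ D := by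
    have hiR : Integrable (fun y : E d => A * (2 * (1 + ‖y‖ ^ 4 / τ ^ 4))) Q :=
      (((integrable_const (1 : ℝ)).add (hi4.div_const (τ ^ 4))).const_mul 2).const_mul A
    have hiL := (hiTe.sub (hie.const_mul V)).sub (hi2.sub (integrable_const V))
    have hmono : ∫ y, (⟪v, y⟫ ^ 2 * Real.exp (b y) - V * Real.exp (b y) - (⟪v, y⟫ ^ 2 - V)) ∂Q ≤
        ∫ y, A * (2 * (1 + ‖y‖ ^ 4 / τ ^ 4)) ∂Q := by
      refine integral_mono hiL hiR fun y => ?_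
      have := inner_sq_sub_mul_exp_sub_one_le hτ hH hβ0 hβ1 hV0 hVle (hbB y) (hbH y)
      simp only
      linarith
    refine hmono.trans ?_
    rw [integral_const_mul, integral_const_mul, integral_add (integrable_const _)
      (hi4.div_const _), integral_div, hD]
    have h4 : (∫ y, ‖y‖ ^ 4 ∂Q) / τ ^ 4 ≤ 144 * d ^ 2 := by
      rw [div_le_iff₀ (by positivity)]
      exact hQ.integral_norm_pow_four_le h0 hτ
    gcongr
    simp
  have iVe : Integrable (fun y => V * Real.exp (b y)) Q := hie.const_mul V
  have iTV : Integrable (fun y => ⟪v, y⟫ ^ 2 - V) Q := hi2.sub (integrable_const V)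
  have iTVe : Integrable (fun y => ⟪v, y⟫ ^ 2 * Real.exp (b y) - V * Real.exp (b y)) Q :=
    hiTe.sub iVe
  have hsplit : ∫ y, ⟪v, y⟫ ^ 2 * Real.exp (b y) ∂Q - V * ∫ y, Real.exp (b y) ∂Q ≤ D := by
    rw [integral_sub iTVe iTV, integral_sub hiTe iVe, integral_sub hi2 (integrable_const V),
      integral_const_mul, ← hV] at hdev
    simpa using hdev
  have hlow : Real.exp (-B) ≤ ∫ y, Real.exp (b y) ∂Q := by
    have := integral_mono (integrable_const (Real.exp (-B))) hie
      fun y => Real.exp_le_exp.2 (abs_le.1 (hbB y)).1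
    simpa using this
  have hDe : D ≤ ‖v‖ ^ 2 * τ ^ 2 * (tiltConst d B H * τ ^ β) * ∫ y, Real.exp (b y) ∂Q := by
    have h2B : Real.exp (2 * B) * Real.exp (-B) = Real.exp B := by
      rw [← Real.exp_add]; ring_nf
    have : D = ‖v‖ ^ 2 * τ ^ 2 * (tiltConst d B H * τ ^ β) * Real.exp (-B) := by
      rw [hD, hA, tiltConst, ← h2B]; ring
    rw [this]
    have := tiltConst_nonneg (d := d) (B := B) hH
    gcongr
  have he0 : 0 ≤ ∫ y, Real.exp (b y) ∂Q := (Real.exp_pos _).le.trans hlow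
  nlinarith [mul_le_mul_of_nonneg_right hVle he0]

/-- The variance bound for a perturbation `exp a` of a measure with arbitrary mean. -/
lemma IsLaplaceSubgaussian.exists_integral_inner_sub_sq_mul_exp_le {τ : ℝ} {Q : Measure (E d)}
    (hQ : IsLaplaceSubgaussian τ Q) (hτ : 0 < τ) {a : E d → ℝ}
    (ham : Measurable a) {B H β : ℝ} (hH : 0 ≤ H) (hβ0 : 0 < β) (hβ1 : β ≤ 1)
    (haB : ∀ y, |a y| ≤ B) (haH : ∀ x y, |a x - a y| ≤ H * ‖x - y‖ ^ β) (v : E d) :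
    ∃ k : ℝ, ∫ y, (⟪v, y⟫ - k) ^ 2 * Real.exp (a y) ∂Q ≤
      ‖v‖ ^ 2 * τ ^ 2 * (1 + tiltConst d (2 * B) H * τ ^ β) * ∫ y, Real.exp (a y) ∂Q := by
  set c := ∫ z, z ∂Q with hc
  have hbm : Measurable fun y => a (y + c) - a c := by fun_prop
  have key := hQ.map_sub_mean.integral_inner_sq_mul_exp_le hQ.integral_map_sub_mean hτ
    (b := fun y => a (y + c) - a c) (B := 2 * B) hbm hH hβ0 hβ1
    (fun y => by
      have h1 := abs_le.1 (haB (y + c))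
      have h2 := abs_le.1 (haB c)
      exact abs_le.2 ⟨by linarith, by linarith⟩)
    (fun y => by simpa using haH (y + c) c) v
  rw [integral_map (by fun_prop) (Measurable.aestronglyMeasurable (by fun_prop)),
    integral_map (by fun_prop) (Measurable.aestronglyMeasurable (by fun_prop)), ← hc] at key
  simp only [sub_add_cancel, Real.exp_sub, mul_div_assoc', integral_div] at key
  rw [div_le_div_iff_of_pos_right (Real.exp_pos _)] at key
  refine ⟨⟪v, c⟫, ?_⟩
  simpa only [inner_sub_right] using key

/-! ### Strongly log-concave densities -/

lemma integral_densityMeasure_of_nonneg {q : E d → ℝ} (hq : Measurable q) (hq0 : ∀ y, 0 ≤ q y)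
    (f : E d → ℝ) : ∫ y, f y ∂(densityMeasure q) = ∫ y, q y * f y := by
  unfold densityMeasure
  rw [integral_withDensity_eq_integral_toReal_smul (by fun_prop) (by simp)]
  refine integral_congr_ae (Filter.Eventually.of_forall fun y => ?_)
  simp only
  rw [ENNReal.toReal_ofReal (hq0 y), smul_eq_mul]

lemma integrable_densityMeasure_iff {q : E d → ℝ} (hq : Measurable q) (hq0 : ∀ y, 0 ≤ q y)
    {f : E d → ℝ} : Integrable f (densityMeasure q) ↔ Integrable fun y => q y * f y := by
  unfold densityMeasure
  rw [integrable_withDensity_iff_integrable_smul' (by fun_prop) (by simp)]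
  refine integrable_congr (Filter.Eventually.of_forall fun y => ?_)
  simp only
  rw [ENNReal.toReal_ofReal (hq0 y), smul_eq_mul]

/-- A nonnegative function `q` on `ℝ^d`, with finite exponential moments and positive integral,
that is strongly log-concave with parameter `τ⁻²` along midpoints: `-log q` is as convex as
`‖y‖ ^ 2 / (2 * τ ^ 2)`. -/
structure IsStronglyLogConcave (τ : ℝ) (q : E d → ℝ) : Prop where
  measurable : Measurable q
  nonneg : ∀ y, 0 ≤ q y
  integral_pos : 0 < ∫ y, q y
  integrable_mul_exp : ∀ h : E d, Integrable fun y => q y * Real.exp ⟪h, y⟫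
  mul_le : ∀ x y, q x * q y ≤
    q (midpoint ℝ x y) ^ 2 * Real.exp (-(‖x - y‖ ^ 2 / (4 * τ ^ 2)))

namespace IsStronglyLogConcave

variable {τ : ℝ} {q : E d → ℝ}

/-- The Prékopa–Leindler inequality for `q * exp ⟪h, ·⟫`, `q * exp ⟪-h, ·⟫` and a multiple of
`q`. -/
lemma integral_mul_integral_le (hq : IsStronglyLogConcave τ q) (hτ : 0 < τ) (h : E d) :
    (∫ y, q y * Real.exp ⟪h, y⟫) * (∫ y, q y * Real.exp ⟪-h, y⟫) ≤
      Real.exp (τ ^ 2 * ‖h‖ ^ 2) * (∫ y, q y) ^ 2 := by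
  have hqm := hq.measurable
  set e := Real.exp (τ ^ 2 * ‖h‖ ^ 2 / 2) with he
  have hqi : Integrable q := by simpa using hq.integrable_mul_exp 0
  have n1 : ∀ k y : E d, 0 ≤ q y * Real.exp ⟪k, y⟫ := fun k y =>
    mul_nonneg (hq.nonneg y) (Real.exp_pos _).le
  have n2 : ∀ y, 0 ≤ e * q y := fun y => mul_nonneg (Real.exp_pos _).le (hq.nonneg y)
  have key := prekopa_leindler (f := fun y => ENNReal.ofReal (q y * Real.exp ⟪h, y⟫))
    (g := fun y => ENNReal.ofReal (q y * Real.exp ⟪-h, y⟫))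
    (h := fun y => ENNReal.ofReal (e * q y)) (by fun_prop) (by fun_prop) (by fun_prop) ?_
  · rw [← ofReal_integral_eq_lintegral_ofReal (hq.integrable_mul_exp h)
      (Filter.Eventually.of_forall (n1 h)), ← ofReal_integral_eq_lintegral_ofReal
      (hq.integrable_mul_exp (-h)) (Filter.Eventually.of_forall (n1 (-h))),
      ← ofReal_integral_eq_lintegral_ofReal (hqi.const_mul e) (Filter.Eventually.of_forall n2),
      ← ENNReal.ofReal_mul (integral_nonneg (n1 h)), ← ENNReal.ofReal_pow (integral_nonneg n2),
      ENNReal.ofReal_le_ofReal_iff (by positivity), integral_const_mul, mul_pow] at key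
    convert key using 2
    rw [he, ← Real.exp_nat_mul]
    congr 1; push_cast; ring
  · intro x y
    rw [← ENNReal.ofReal_mul (n1 h x), ← ENNReal.ofReal_pow (n2 _)]
    refine ENNReal.ofReal_le_ofReal ?_
    have h1 : ⟪h, x⟫ + ⟪-h, y⟫ ≤ ‖x - y‖ ^ 2 / (4 * τ ^ 2) + τ ^ 2 * ‖h‖ ^ 2 := by
      have h2 := real_inner_le_norm h (x - y)
      rw [inner_sub_right] at h2
      rw [inner_neg_left]
      have h3 : ‖h‖ * ‖x - y‖ ≤ ‖x - y‖ ^ 2 / (4 * τ ^ 2) + τ ^ 2 * ‖h‖ ^ 2 := by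
        have : ‖x - y‖ ^ 2 / (4 * τ ^ 2) + τ ^ 2 * ‖h‖ ^ 2 - ‖h‖ * ‖x - y‖ =
          (‖x - y‖ / (2 * τ) - τ * ‖h‖) ^ 2 := by field_simp; ring
        nlinarith [sq_nonneg (‖x - y‖ / (2 * τ) - τ * ‖h‖)]
      linarith
    calc _ = q x * q y * Real.exp (⟪h, x⟫ + ⟪-h, y⟫) := by rw [Real.exp_add]; ring
      _ ≤ (q (midpoint ℝ x y) ^ 2 * Real.exp (-(‖x - y‖ ^ 2 / (4 * τ ^ 2)))) *
          Real.exp (‖x - y‖ ^ 2 / (4 * τ ^ 2) + τ ^ 2 * ‖h‖ ^ 2) := by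
        exact mul_le_mul (hq.mul_le x y) (Real.exp_le_exp.2 h1) (Real.exp_pos _).le (by positivity)
      _ = (e * q (midpoint ℝ x y)) ^ 2 := by
        rw [mul_assoc, ← Real.exp_add, mul_pow, he, ← Real.exp_nat_mul]
        push_cast
        ring_nf

lemma isLaplaceSubgaussian (hq : IsStronglyLogConcave τ q) (hτ : 0 < τ) :
    IsLaplaceSubgaussian τ (densityMeasure fun y => (∫ z, q z)⁻¹ * q y) := by
  have hqm := hq.measurable
  have hqi : Integrable q := by simpa using hq.integrable_mul_exp 0
  have hp := hq.integral_pos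
  have n1 : ∀ y, 0 ≤ (∫ z, q z)⁻¹ * q y := fun y => mul_nonneg (inv_nonneg.2 hp.le) (hq.nonneg y)
  refine ⟨⟨?_⟩, fun h => ?_, fun h => ?_⟩
  · unfold densityMeasure
    rw [withDensity_apply _ MeasurableSet.univ, Measure.restrict_univ,
      ← ofReal_integral_eq_lintegral_ofReal (hqi.const_mul _) (Filter.Eventually.of_forall n1),
      integral_const_mul, inv_mul_cancel₀ hp.ne', ENNReal.ofReal_one]
  · rw [integrable_densityMeasure_iff (by fun_prop) n1]
    simpa only [mul_assoc] using (hq.integrable_mul_exp h).const_mul (∫ z, q z)⁻¹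
  · rw [integral_densityMeasure_of_nonneg (by fun_prop) n1,
      integral_densityMeasure_of_nonneg (by fun_prop) n1]
    simp only [mul_assoc (∫ z, q z)⁻¹, integral_const_mul]
    rw [show ∀ a b c : ℝ, a * (b * (a * c)) = a * a * (b * c) from fun a b c => by ring]
    have := hq.integral_mul_integral_le hτ h
    calc _ ≤ (∫ z, q z)⁻¹ * (∫ z, q z)⁻¹ * (Real.exp (τ ^ 2 * ‖h‖ ^ 2) * (∫ y, q y) ^ 2) := by
          gcongr
      _ = _ := by field_simp

/-- The variance bound for `q * exp a`, where `q` is strongly log-concave and `a` is bounded and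
Hölder continuous. -/
lemma exists_integral_inner_sub_sq_le (hq : IsStronglyLogConcave τ q) (hτ : 0 < τ)
    {a : E d → ℝ} (ham : Measurable a) {B H β : ℝ} (hH : 0 ≤ H) (hβ0 : 0 < β) (hβ1 : β ≤ 1)
    (haB : ∀ y, |a y| ≤ B) (haH : ∀ x y, |a x - a y| ≤ H * ‖x - y‖ ^ β) (v : E d) :
    ∃ k : ℝ, ∫ y, (⟪v, y⟫ - k) ^ 2 * (q y * Real.exp (a y)) ≤
      ‖v‖ ^ 2 * τ ^ 2 * (1 + tiltConst d (2 * B) H * τ ^ β) * ∫ y, q y * Real.exp (a y) := by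
  obtain ⟨k, hk⟩ := (hq.isLaplaceSubgaussian hτ).exists_integral_inner_sub_sq_mul_exp_le hτ ham hH
    hβ0 hβ1 haB haH v
  refine ⟨k, ?_⟩
  have hqm := hq.measurable
  have n1 : ∀ y, 0 ≤ (∫ z, q z)⁻¹ * q y := fun y =>
    mul_nonneg (inv_nonneg.2 hq.integral_pos.le) (hq.nonneg y)
  rw [integral_densityMeasure_of_nonneg (by fun_prop) n1,
    integral_densityMeasure_of_nonneg (by fun_prop) n1] at hk
  simp only [mul_assoc (∫ z, q z)⁻¹, integral_const_mul] at hk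
  rw [mul_left_comm, mul_le_mul_iff_right₀ (inv_pos.2 hq.integral_pos)] at hk
  simpa only [mul_left_comm] using hk

end IsStronglyLogConcave

/-! ### Smoothness of Gaussian mixtures -/

/-- Differentiation under the integral in a mixture of translates of `φ`. -/
lemma hasFDerivAt_integral_smul_comp_sub {F : Type*} [NormedAddCommGroup F] [NormedSpace ℝ F]
    {p : E d → ℝ} (hp : Integrable p) {φ : E d → F} {φ' : E d → E d →L[ℝ] F}
    (hφ : ∀ x, HasFDerivAt φ (φ' x) x) (hc' : Continuous φ') {B B' : ℝ} (hB : ∀ x, ‖φ x‖ ≤ B)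
    (hB' : ∀ x, ‖φ' x‖ ≤ B') (m : ℝ) (x : E d) :
    HasFDerivAt (fun x => ∫ y, p y • φ (x - m • y)) (∫ y, p y • φ' (x - m • y)) x := by
  have hc : Continuous φ := continuous_iff_continuousAt.2 fun x => (hφ x).continuousAt
  have hm : ∀ x, AEStronglyMeasurable (fun y => p y • φ (x - m • y)) := fun x =>
    hp.1.smul (Continuous.aestronglyMeasurable (by fun_prop))
  have hm' : ∀ x, AEStronglyMeasurable (fun y => p y • φ' (x - m • y)) := fun x =>
    hp.1.smul (Continuous.aestronglyMeasurable (by fun_prop))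
  refine hasFDerivAt_integral_of_dominated_of_fderiv_le (s := univ)
    (F' := fun x y => p y • φ' (x - m • y)) (bound := fun y => ‖p y‖ * B') Filter.univ_mem
    (Filter.Eventually.of_forall hm) ?_ (hm' x) ?_ (hp.norm.mul_const B') ?_
  · refine (hp.norm.mul_const B).mono' (hm x) (Filter.Eventually.of_forall fun y => ?_)
    rw [norm_smul]
    gcongr
    exact hB _
  · refine Filter.Eventually.of_forall fun y x _ => ?_
    rw [norm_smul]
    gcongr
    exact hB' _
  · refine Filter.Eventually.of_forall fun y x _ => ?_
    exact ((hφ (x - m • y)).comp x ((hasFDerivAt_id x).sub_const (m • y))).const_smul (p y)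

lemma continuous_integral_smul_comp_sub {F : Type*} [NormedAddCommGroup F] [NormedSpace ℝ F]
    {p : E d → ℝ} (hp : Integrable p) {φ : E d → F} (hc : Continuous φ) {B : ℝ}
    (hB : ∀ x, ‖φ x‖ ≤ B) (m : ℝ) : Continuous fun x => ∫ y, p y • φ (x - m • y) := by
  refine continuous_of_dominated (bound := fun y => ‖p y‖ * B)
    (fun x => hp.1.smul (Continuous.aestronglyMeasurable (by fun_prop))) (fun x => ?_)
    (hp.norm.mul_const B) (Filter.Eventually.of_forall fun y => by fun_prop)
  refine Filter.Eventually.of_forall fun y => ?_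
  rw [norm_smul]
  gcongr
  exact hB _

lemma contDiff_two_integral_smul_comp_sub {p : E d → ℝ} (hp : Integrable p) {φ : E d → ℝ}
    {φ' : E d → E d →L[ℝ] ℝ} {φ'' : E d → E d →L[ℝ] E d →L[ℝ] ℝ}
    (hφ : ∀ x, HasFDerivAt φ (φ' x) x) (hφ' : ∀ x, HasFDerivAt φ' (φ'' x) x)
    (hc : Continuous φ'') {B B' B'' : ℝ} (hB : ∀ x, ‖φ x‖ ≤ B) (hB' : ∀ x, ‖φ' x‖ ≤ B')
    (hB'' : ∀ x, ‖φ'' x‖ ≤ B'') (m : ℝ) :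
    ContDiff ℝ 2 fun x => ∫ y, p y • φ (x - m • y) := by
  have hc' : Continuous φ' := continuous_iff_continuousAt.2 fun x => (hφ' x).continuousAt
  have h1 : ContDiff ℝ ((0 : ℕ) + 1) fun x => ∫ y, p y • φ' (x - m • y) :=
    contDiff_succ_iff_hasFDerivAt.2 ⟨_, contDiff_zero.2 (continuous_integral_smul_comp_sub hp hc
      hB'' m), fun x => hasFDerivAt_integral_smul_comp_sub hp hφ' hc hB' hB'' m x⟩
  have h2 : ContDiff ℝ ((1 : ℕ) + 1) fun x => ∫ y, p y • φ (x - m • y) :=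
    contDiff_succ_iff_hasFDerivAt.2 ⟨_, by simpa using h1, fun x =>
      hasFDerivAt_integral_smul_comp_sub hp hφ hc' hB hB' m x⟩
  rw [show ((1 : ℕ) : WithTop ℕ∞) + 1 = 2 by norm_num] at h2
  exact h2

set_option maxSynthPendingDepth 3 in
lemma exists_bounded_fderiv_exp_neg_sq {W : Type*} [NormedAddCommGroup W] [InnerProductSpace ℝ W]
    {b : ℝ} (hb : 0 < b) : ∃ (φ' : W → W →L[ℝ] ℝ) (φ'' : W → W →L[ℝ] W →L[ℝ] ℝ) (B' B'' : ℝ),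
      (∀ x, HasFDerivAt (fun x : W => Real.exp (-(b * ‖x‖ ^ 2))) (φ' x) x) ∧
      (∀ x, HasFDerivAt φ' (φ'' x) x) ∧ Continuous φ'' ∧ (∀ x, ‖φ' x‖ ≤ B') ∧
      ∀ x, ‖φ'' x‖ ≤ B'' := by
  obtain ⟨J, hJ⟩ : ∃ J : W →L[ℝ] W →L[ℝ] ℝ, ∀ x y, J x y = -(2 * b) * ⟪x, y⟫ :=
    ⟨(-(2 * b)) • (innerSL ℝ : W →L[ℝ] W →L[ℝ] ℝ), fun x y => by
      simp only [smul_apply, smul_eq_mul]; rfl⟩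
  have hin : ∀ x : W, HasFDerivAt (fun x : W => -(b * ‖x‖ ^ 2)) (J x) x := by
    intro x
    have := (((hasFDerivAt_id x).norm_sq).const_mul b).neg
    refine this.congr_fderiv ?_
    ext y
    simp [hJ]
    ring
  have hJx : ∀ x, ‖J x‖ ≤ 2 * b * ‖x‖ := fun x =>
    ContinuousLinearMap.opNorm_le_bound _ (by positivity) fun y => by
      rw [hJ, norm_mul, norm_neg, Real.norm_of_nonneg (by positivity)]
      exact (mul_le_mul_of_nonneg_left (norm_inner_le_norm (𝕜 := ℝ) x y) (by positivity)).trans_eq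
        (mul_assoc _ _ _).symm
  have hJn : ‖J‖ ≤ 2 * b := ContinuousLinearMap.opNorm_le_bound _ (by positivity) hJx
  have hφ : ∀ x : W, HasFDerivAt (fun x : W => Real.exp (-(b * ‖x‖ ^ 2)))
      (Real.exp (-(b * ‖x‖ ^ 2)) • J x) x := fun x => (hin x).exp
  have hφ' : ∀ x : W, HasFDerivAt (fun x : W => Real.exp (-(b * ‖x‖ ^ 2)) • J x)
      (Real.exp (-(b * ‖x‖ ^ 2)) • J + (Real.exp (-(b * ‖x‖ ^ 2)) • J x).smulRight (J x)) x :=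
    fun x => (hφ x).smul J.hasFDerivAt
  have he1 : ∀ x : W, Real.exp (-(b * ‖x‖ ^ 2)) ≤ 1 := fun x =>
    Real.exp_le_one_iff.2 (neg_nonpos.2 (by positivity))
  have he2 : ∀ x : W, Real.exp (-(b * ‖x‖ ^ 2)) * (b * ‖x‖ ^ 2) ≤ 1 := fun x => by
    have := Real.mul_exp_neg_le_exp_neg_one (b * ‖x‖ ^ 2)
    have h1 : Real.exp (-1) ≤ 1 := Real.exp_le_one_iff.2 (by norm_num)
    linarith
  refine ⟨_, _, b + 1, 2 * b + 4 * b, hφ, hφ', ?_, fun x => ?_, fun x => ?_⟩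
  · have hc : Continuous fun x : W => Real.exp (-(b * ‖x‖ ^ 2)) := by fun_prop
    refine Continuous.add (hc.smul continuous_const) ?_
    exact (ContinuousLinearMap.smulRightL ℝ W (W →L[ℝ] ℝ)).continuous₂.comp
      (Continuous.prodMk (hc.smul J.continuous) J.continuous)
  · rw [norm_smul, Real.norm_of_nonneg (Real.exp_pos _).le]
    calc _ ≤ Real.exp (-(b * ‖x‖ ^ 2)) * (2 * b * ‖x‖) := by gcongr; exact hJx x
      _ ≤ Real.exp (-(b * ‖x‖ ^ 2)) * (b + b * ‖x‖ ^ 2) := by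
        gcongr; nlinarith [sq_nonneg (‖x‖ - 1)]
      _ ≤ b + 1 := by nlinarith [he1 x, he2 x]
  · refine (norm_add_le _ _).trans (add_le_add ?_ ?_)
    · rw [norm_smul, Real.norm_of_nonneg (Real.exp_pos _).le]
      exact (mul_le_mul (he1 x) hJn (norm_nonneg _) zero_le_one).trans (one_mul _).le
    · rw [ContinuousLinearMap.norm_smulRight_apply, norm_smul,
        Real.norm_of_nonneg (Real.exp_pos _).le]
      calc _ ≤ Real.exp (-(b * ‖x‖ ^ 2)) * (2 * b * ‖x‖) * (2 * b * ‖x‖) := by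
            gcongr <;> exact hJx x
        _ = 4 * b * (Real.exp (-(b * ‖x‖ ^ 2)) * (b * ‖x‖ ^ 2)) := by ring
        _ ≤ 4 * b := mul_le_of_le_one_right (by positivity) (he2 x)

lemma contDiff_two_integral_mul_exp_neg_sq {p : E d → ℝ} (hp : Integrable p) {b : ℝ} (hb : 0 < b)
    (m : ℝ) : ContDiff ℝ 2 fun x => ∫ y, p y • Real.exp (-(b * ‖x - m • y‖ ^ 2)) := by
  obtain ⟨φ', φ'', B', B'', h1, h2, hc, hB', hB''⟩ := exists_bounded_fderiv_exp_neg_sq (W := E d) hb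
  refine contDiff_two_integral_smul_comp_sub hp h1 h2 hc (B := 1) (fun x => ?_) hB' hB'' m
  rw [Real.norm_of_nonneg (Real.exp_pos _).le]
  exact Real.exp_le_one_iff.2 (neg_nonpos.2 (by positivity))

lemma contDiff_two_integral_gaussianDensity {p : E d → ℝ} (hp : Integrable p) {w : ℝ} (hw : 0 < w)
    (m : ℝ) : ContDiff ℝ 2 fun x => ∫ y, p y * gaussianDensity (m • y) w x := by
  have h := (contDiff_two_integral_mul_exp_neg_sq hp (b := 1 / (2 * w))
    (by positivity) m).const_smul ((2 * Real.pi * w) ^ (-(d : ℝ) / 2))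
  convert h using 2 with x
  rw [← integral_smul]
  refine integral_congr_ae (Filter.Eventually.of_forall fun y => ?_)
  simp only [gaussianDensity, smul_eq_mul]
  rw [show ‖x - m • y‖ ^ 2 / (2 * w) = 1 / (2 * w) * ‖x - m • y‖ ^ 2 by ring]
  ring

/-! ### Posterior densities -/

/-- The unnormalized density of `X` given `m X + √w Z = x`, for `X` of density `p` and an
independent standard Gaussian `Z`; factors that do not depend on `y` are dropped. -/
noncomputable def posteriorWeight (p : E d → ℝ) (m w : ℝ) (x y : E d) : ℝ :=
  p y * Real.exp (-(m ^ 2 / (2 * w) * ‖y‖ ^ 2) + m / w * ⟪x, y⟫)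

lemma posteriorWeight_mul_exp (p : E d → ℝ) (m w s : ℝ) (x v y : E d) :
    posteriorWeight p m w x y * Real.exp (s * (m / w * ⟪v, y⟫)) =
      posteriorWeight p m w (x + s • v) y := by
  unfold posteriorWeight
  rw [mul_assoc, ← Real.exp_add, inner_add_left, inner_smul_left, conj_trivial]
  ring_nf

lemma measurable_posteriorWeight {p : E d → ℝ} (hp : Measurable p) (m w : ℝ) (x : E d) :
    Measurable (posteriorWeight p m w x) := by
  unfold posteriorWeight; fun_prop

lemma integrable_mul_exp_neg_sq_add_inner {p : E d → ℝ} (hp : Integrable p) {b : ℝ} (hb : 0 < b)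
    (h : E d) : Integrable fun y => p y * Real.exp (-(b * ‖y‖ ^ 2) + ⟪h, y⟫) := by
  refine hp.mul_bdd (c := Real.exp (‖h‖ ^ 2 / (4 * b))) (by fun_prop)
    (Filter.Eventually.of_forall fun y => ?_)
  rw [Real.norm_of_nonneg (Real.exp_pos _).le]
  refine Real.exp_le_exp.2 ?_
  have h1 := real_inner_le_norm h y
  have h2 : -(b * ‖y‖ ^ 2) + ‖h‖ * ‖y‖ =
      ‖h‖ ^ 2 / (4 * b) - b * (‖y‖ - ‖h‖ / (2 * b)) ^ 2 := by field_simp; ring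
  have h3 : 0 ≤ b * (‖y‖ - ‖h‖ / (2 * b)) ^ 2 := by positivity
  linarith

lemma integrable_posteriorWeight {p : E d → ℝ} (hp : Integrable p) {m w : ℝ} (hm : 0 < m)
    (hw : 0 < w) (x : E d) : Integrable (posteriorWeight p m w x) := by
  have := integrable_mul_exp_neg_sq_add_inner hp (b := m ^ 2 / (2 * w)) (by positivity)
    ((m / w) • x)
  simp only [inner_smul_left, conj_trivial] at this
  exact this

lemma OUScore.IsProbDensity.integrable {p : E d → ℝ} (hp : IsProbDensity p) : Integrable p :=
  ⟨hp.measurable.aestronglyMeasurable, by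
    rw [hasFiniteIntegral_iff_ofReal (Filter.Eventually.of_forall hp.nonneg), hp.lintegral_eq_one]
    exact ENNReal.one_lt_top⟩

lemma integral_mul_pos_of_forall_pos {p : E d → ℝ} (hp : IsProbDensity p) {f : E d → ℝ}
    (hf : ∀ y, 0 < f y) (hi : Integrable fun y => p y * f y) : 0 < ∫ y, p y * f y := by
  refine lt_of_le_of_ne (integral_nonneg fun y => mul_nonneg (hp.nonneg y) (hf y).le) fun h => ?_
  have h0 := (integral_eq_zero_iff_of_nonneg
    (fun y => mul_nonneg (hp.nonneg y) (hf y).le) hi).1 h.symm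
  have h1 : ∫⁻ y, ENNReal.ofReal (p y) = 0 := by
    rw [lintegral_eq_zero_iff hp.measurable.ennreal_ofReal]
    filter_upwards [h0] with y hy
    have hy : p y * f y = 0 := hy
    rcases mul_eq_zero.1 hy with h | h
    · simp [h]
    · exact absurd h (hf y).ne'
  rw [hp.lintegral_eq_one] at h1
  exact one_ne_zero h1

lemma integral_posteriorWeight_pos {p : E d → ℝ} (hp : IsProbDensity p) {m w : ℝ} (hm : 0 < m)
    (hw : 0 < w) (x : E d) : 0 < ∫ y, posteriorWeight p m w x y :=
  integral_mul_pos_of_forall_pos hp (fun _ => Real.exp_pos _)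
    (integrable_posteriorWeight hp.integrable hm hw x)

/-- Expanding the square in the Gaussian kernel. -/
lemma integral_mul_gaussianDensity (p : E d → ℝ) {m w : ℝ} (hw : 0 < w) (x : E d) :
    ∫ y, p y * gaussianDensity (m • y) w x =
      (2 * Real.pi * w) ^ (-(d : ℝ) / 2) * Real.exp (-(‖x‖ ^ 2 / (2 * w))) *
        ∫ y, posteriorWeight p m w x y := by
  rw [← integral_const_mul]
  refine integral_congr_ae (Filter.Eventually.of_forall fun y => ?_)
  simp only [gaussianDensity, posteriorWeight]
  rw [show -(‖x - m • y‖ ^ 2 / (2 * w)) = -(‖x‖ ^ 2 / (2 * w)) +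
      (-(m ^ 2 / (2 * w) * ‖y‖ ^ 2) + m / w * ⟪x, y⟫) by
    rw [norm_sub_sq_real, inner_smul_right, norm_smul, mul_pow, Real.norm_eq_abs, sq_abs]
    field_simp
    ring, Real.exp_add]
  ring

lemma iteratedDeriv_two_cgf_zero_le {Ω : Type*} [MeasurableSpace Ω] {μ : Measure Ω}
    [IsFiniteMeasure μ] {X : Ω → ℝ} (h : ∀ s : ℝ, Integrable (fun ω => Real.exp (s * X ω)) μ)
    (hμ : 0 < μ.real univ) (k : ℝ) :
    iteratedDeriv 2 (cgf X μ) 0 ≤ (∫ ω, (X ω - k) ^ 2 ∂μ) / μ.real univ := by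
  have h0 : (0 : ℝ) ∈ interior (integrableExpSet X μ) := by
    rw [show integrableExpSet X μ = univ from eq_univ_of_forall h]; simp
  rw [iteratedDeriv_two_cgf h0, deriv_cgf_zero h0, mgf_zero']
  simp only [zero_mul, Real.exp_zero, mul_one]
  have hi1 : Integrable X μ := by
    simpa using integrable_pow_of_integrable_exp_mul one_ne_zero (h 1) (h (-1)) 1
  have hi2 : Integrable (fun ω => X ω ^ 2) μ :=
    integrable_pow_of_integrable_exp_mul one_ne_zero (h 1) (h (-1)) 2
  have hs : ∫ ω, (X ω - k) ^ 2 ∂μ =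
      ∫ ω, X ω ^ 2 ∂μ - 2 * k * ∫ ω, X ω ∂μ + k ^ 2 * μ.real univ := by
    have e : ∀ ω, (X ω - k) ^ 2 = X ω ^ 2 - 2 * k * X ω + k ^ 2 := fun ω => by ring
    have hi : Integrable (fun ω => 2 * k * X ω) μ := hi1.const_mul _
    simp_rw [e]
    have hi3 : Integrable (fun ω => X ω ^ 2 - 2 * k * X ω) μ := hi2.sub hi
    rw [integral_add hi3 (integrable_const _), integral_sub hi2 hi, integral_const_mul,
      integral_const, smul_eq_mul]
    ring
  rw [hs]
  have : (∫ ω, X ω ^ 2 ∂μ - 2 * k * ∫ ω, X ω ∂μ + k ^ 2 * μ.real univ) / μ.real univ =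
      (∫ ω, X ω ^ 2 ∂μ) / μ.real univ - ((∫ ω, X ω ∂μ) / μ.real univ) ^ 2 +
        (k - (∫ ω, X ω ∂μ) / μ.real univ) ^ 2 := by
    field_simp
    ring
  rw [this]
  linarith [sq_nonneg (k - (∫ ω, X ω ∂μ) / μ.real univ)]

/-- The second derivative of the logarithm of a Gaussian mixture in the direction `v` is
`-‖v‖ ^ 2 / w` plus the variance of `m / w * ⟪v, ·⟫` under the posterior at `x`. -/
lemma iteratedDeriv_two_log_integral_gaussianDensity_le {p : E d → ℝ} (hp : IsProbDensity p)
    {m w : ℝ} (hm : 0 < m) (hw : 0 < w) (x v : E d) {k V : ℝ}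
    (hV : ∫ y, (⟪v, y⟫ - k) ^ 2 * posteriorWeight p m w x y ≤
      V * ∫ y, posteriorWeight p m w x y) :
    iteratedDeriv 2
        (fun s : ℝ => Real.log (∫ y, p y * gaussianDensity (m • y) w (x + s • v))) 0 ≤
      -(‖v‖ ^ 2 / w) + m ^ 2 / w ^ 2 * V := by
  set ν := densityMeasure (posteriorWeight p m w x)
  set X : E d → ℝ := fun y => m / w * ⟪v, y⟫ with hX
  have hpm := measurable_posteriorWeight hp.measurable m w x
  have hp0 : ∀ x y, 0 ≤ posteriorWeight p m w x y := fun x y =>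
    mul_nonneg (hp.nonneg y) (Real.exp_pos _).le
  have hpi := integrable_posteriorWeight hp.integrable hm hw
  have hpos := integral_posteriorWeight_pos hp hm hw
  have : IsFiniteMeasure ν := isFiniteMeasure_withDensity_ofReal (hpi x).2
  have hexp : ∀ s : ℝ, Integrable (fun y => Real.exp (s * X y)) ν := fun s => by
    rw [integrable_densityMeasure_iff hpm (hp0 x)]
    simp only [hX, posteriorWeight_mul_exp]
    exact hpi _
  have hmgf : ∀ s, mgf X ν s = ∫ y, posteriorWeight p m w (x + s • v) y := fun s => by
    rw [mgf, integral_densityMeasure_of_nonneg hpm (hp0 x)]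
    simp only [hX, posteriorWeight_mul_exp]
  have hreal : ν.real univ = ∫ y, posteriorWeight p m w x y := by
    rw [← mgf_zero', hmgf]; simp
  set c := (2 * Real.pi * w) ^ (-(d : ℝ) / 2) with hc
  have hc0 : 0 < c := by positivity
  have hlog : (fun s : ℝ => Real.log (∫ y, p y * gaussianDensity (m • y) w (x + s • v))) =
      fun s => (Real.log c - ‖x + s • v‖ ^ 2 / (2 * w)) + cgf X ν s := by
    ext s
    rw [integral_mul_gaussianDensity p hw, Real.log_mul (by positivity) (hpos _).ne',
      Real.log_mul hc0.ne' (Real.exp_pos _).ne', Real.log_exp, cgf, hmgf]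
    ring
  have h0 : (0 : ℝ) ∈ interior (integrableExpSet X ν) := by
    rw [show integrableExpSet X ν = univ from eq_univ_of_forall hexp]; simp
  have hquad : iteratedDeriv 2 (fun s : ℝ => Real.log c - ‖x + s • v‖ ^ 2 / (2 * w)) 0 =
      -(‖v‖ ^ 2 / w) := by
    have e : (fun s : ℝ => Real.log c - ‖x + s • v‖ ^ 2 / (2 * w)) = fun s =>
        Real.log c - (‖x‖ ^ 2 + 2 * ⟪x, v⟫ * s + ‖v‖ ^ 2 * s ^ 2) / (2 * w) := by
      ext s
      rw [norm_add_sq_real, inner_smul_right, norm_smul, mul_pow, Real.norm_eq_abs, sq_abs]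
      ring
    have d1 : deriv (fun s : ℝ => Real.log c -
        (‖x‖ ^ 2 + 2 * ⟪x, v⟫ * s + ‖v‖ ^ 2 * s ^ 2) / (2 * w)) = fun s =>
        -((2 * ⟪x, v⟫ + ‖v‖ ^ 2 * (2 * s)) / (2 * w)) := by
      ext s
      have h1 := ((((hasDerivAt_id s).const_mul (2 * ⟪x, v⟫)).const_add (‖x‖ ^ 2)).add
        (((hasDerivAt_id s).pow 2).const_mul (‖v‖ ^ 2))).div_const (2 * w)
      have h2 := h1.const_sub (Real.log c)
      simpa using h2.deriv
    have d2 : HasDerivAt (fun s : ℝ => -((2 * ⟪x, v⟫ + ‖v‖ ^ 2 * (2 * s)) / (2 * w)))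
        (-(‖v‖ ^ 2 / w)) 0 := by
      have h1 := (((((hasDerivAt_id (0 : ℝ)).const_mul 2).const_mul (‖v‖ ^ 2)).const_add
        (2 * ⟪x, v⟫)).div_const (2 * w)).neg
      refine h1.congr_deriv ?_
      field_simp
    rw [e, iteratedDeriv_succ, iteratedDeriv_one, d1, d2.deriv]
  rw [hlog, iteratedDeriv_fun_add, hquad]
  · gcongr
    refine (iteratedDeriv_two_cgf_zero_le hexp (hreal ▸ hpos x) (m / w * k)).trans ?_
    rw [hreal, div_le_iff₀ (hpos x), integral_densityMeasure_of_nonneg hpm (hp0 x), mul_assoc]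
    have e : ∀ y, posteriorWeight p m w x y * (X y - m / w * k) ^ 2 =
        m ^ 2 / w ^ 2 * ((⟪v, y⟫ - k) ^ 2 * posteriorWeight p m w x y) := fun y => by
      simp only [hX]; ring
    simp_rw [e]
    rw [integral_const_mul]
    gcongr
  · have : ContDiff ℝ (2 : ℕ) fun s : ℝ => Real.log c - ‖x + s • v‖ ^ 2 / (2 * w) :=
      contDiff_const.sub
        (((contDiff_const.add (contDiff_id.smul contDiff_const)).norm_sq ℝ).div_const _)
    exact this.contDiffAt
  · exact (analyticAt_cgf h0).contDiffAt

/-! ### From directional second derivatives to the operator bounds -/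

section Gradient

variable {ψ : E d → ℝ}

lemma contDiff_one_gradient (hψ : ContDiff ℝ 2 ψ) : ContDiff ℝ 1 (gradient ψ) :=
  (InnerProductSpace.toDual ℝ (E d)).symm.contDiff.comp
    (hψ.fderiv_right (m := 1) (by norm_num))

lemma inner_gradient_eq_fderiv (x v : E d) : ⟪gradient ψ x, v⟫ = fderiv ℝ ψ x v := by
  rw [gradient, InnerProductSpace.toDual_symm_apply]

lemma hasDerivAt_comp_line (hψ : ContDiff ℝ 2 ψ) (x v : E d) (s : ℝ) :
    HasDerivAt (fun s : ℝ => ψ (x + s • v)) ⟪gradient ψ (x + s • v), v⟫ s := by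
  rw [inner_gradient_eq_fderiv]
  have h1 : HasDerivAt (fun s : ℝ => x + s • v) v s := by
    simpa using ((hasDerivAt_id s).smul_const v).const_add x
  exact ((hψ.differentiable (by norm_num)) _).hasFDerivAt.comp_hasDerivAt s h1

lemma hasDerivAt_inner_gradient_comp_line (hψ : ContDiff ℝ 2 ψ) (x v : E d) (s : ℝ) :
    HasDerivAt (fun s : ℝ => ⟪gradient ψ (x + s • v), v⟫)
      ⟪fderiv ℝ (gradient ψ) (x + s • v) v, v⟫ s := by
  have h1 : HasDerivAt (fun s : ℝ => x + s • v) v s := by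
    simpa using ((hasDerivAt_id s).smul_const v).const_add x
  have h2 := (((contDiff_one_gradient hψ).differentiable one_ne_zero)
    (x + s • v)).hasFDerivAt.comp_hasDerivAt s h1
  simpa using h2.inner ℝ (hasDerivAt_const s v)

lemma iteratedDeriv_two_comp_line (hψ : ContDiff ℝ 2 ψ) (x v : E d) :
    iteratedDeriv 2 (fun s : ℝ => ψ (x + s • v)) 0 = ⟪fderiv ℝ (gradient ψ) x v, v⟫ := by
  have h1 : deriv (fun s : ℝ => ψ (x + s • v)) = fun s => ⟪gradient ψ (x + s • v), v⟫ :=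
    funext fun s => (hasDerivAt_comp_line hψ x v s).deriv
  rw [iteratedDeriv_succ, iteratedDeriv_one, h1,
    (hasDerivAt_inner_gradient_comp_line hψ x v 0).deriv]
  simp

lemma inner_gradient_sub_le (hψ : ContDiff ℝ 2 ψ) {M : ℝ}
    (hM : ∀ x v, iteratedDeriv 2 (fun s : ℝ => ψ (x + s • v)) 0 ≤ M * ‖v‖ ^ 2) (x y : E d) :
    ⟪gradient ψ x - gradient ψ y, x - y⟫ ≤ M * ‖x - y‖ ^ 2 := by
  have hd := hasDerivAt_inner_gradient_comp_line hψ y (x - y)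
  have := image_sub_le_mul_sub_of_deriv_le (fun s => (hd s).differentiableAt)
    (C := M * ‖x - y‖ ^ 2) (fun s => by
      rw [(hd s).deriv, ← iteratedDeriv_two_comp_line hψ]; exact hM _ _) (zero_le_one (α := ℝ))
  simpa [inner_sub_left] using this

lemma lambdaMax_fderiv_gradient_add_id_le (hψ : ContDiff ℝ 2 ψ) {L : ℝ} (hL : 0 ≤ L)
    (hM : ∀ x v, iteratedDeriv 2 (fun s : ℝ => ψ (x + s • v)) 0 ≤ (L - 1) * ‖v‖ ^ 2) (x : E d) :
    lambdaMax (fderiv ℝ (gradient ψ) x + ContinuousLinearMap.id ℝ (E d)) ≤ L := by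
  refine Real.sSup_le (fun c hc => ?_) hL
  obtain ⟨v, hv⟩ := Module.End.HasEigenvalue.exists_hasEigenvector hc
  have h1 : fderiv ℝ (gradient ψ) x v + v = c • v := hv.apply_eq_smul
  have h2 := hM x v
  rw [iteratedDeriv_two_comp_line hψ, eq_sub_of_add_eq h1, inner_sub_left, inner_smul_left,
    conj_trivial, real_inner_self_eq_norm_sq] at h2
  have h3 : 0 < ‖v‖ ^ 2 := pow_pos (norm_pos_iff.2 hv.2) 2
  exact le_of_mul_le_mul_right (by linarith) h3

end Gradient

/-! ### Hölder balls -/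

lemma abs_le_of_enorm_le {K r : ℝ} (hK : 0 ≤ K) (h : ‖r‖ₑ ≤ ENNReal.ofReal K) : |r| ≤ K := by
  rwa [Real.enorm_eq_ofReal_abs, ENNReal.ofReal_le_ofReal_iff hK] at h

lemma foldr_iterate_single (f : E d → ℝ) (i : Fin d) (l : List (Fin d)) (hl : l.Nodup) :
    l.foldr (fun j g => (partialDeriv j)^[(Pi.single i 1 : Fin d → ℕ) j] g) f =
      if i ∈ l then partialDeriv i f else f := by
  induction l with
  | nil => simp
  | cons j l ih =>
    rw [List.foldr_cons, ih hl.of_cons]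
    rcases eq_or_ne j i with rfl | h
    · simp [(List.nodup_cons.1 hl).1]
    · simp [h, h.symm]

lemma multiDeriv_single (f : E d → ℝ) (i : Fin d) :
    multiDeriv (Pi.single i 1) f = partialDeriv i f := by
  rw [multiDeriv, foldr_iterate_single f i _ (List.nodup_finRange d)]
  simp

lemma multiDeriv_zero (f : E d → ℝ) : multiDeriv 0 f = f := by
  rw [multiDeriv]
  induction List.finRange d with
  | nil => rfl
  | cons j l ih => simp

lemma supNorm_multiDeriv_le_holderNorm {η : ℝ} (f : E d → ℝ) {ν : Fin d → ℕ}
    (hν : ∑ i, ν i ≤ ⌊η⌋₊) : supNorm (multiDeriv ν f) ≤ holderNorm η f := by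
  refine le_trans ?_ le_self_add
  refine le_trans ?_ (Finset.single_le_sum (fun _ _ => zero_le)
    (Finset.mem_range.2 (Nat.lt_succ_of_le hν)))
  exact Finset.single_le_sum (f := fun ν => supNorm (multiDeriv ν f)) (fun _ _ => zero_le)
    (Finset.mem_piAntidiag.2 ⟨rfl, fun i _ => Finset.mem_univ i⟩)

lemma abs_multiDeriv_le_of_mem_holderBall {η K : ℝ} (hK : 0 ≤ K) {a : E d → ℝ}
    (ha : a ∈ HolderBall d η K) {ν : Fin d → ℕ} (hν : ∑ i, ν i ≤ ⌊η⌋₊) (x : E d) :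
    |multiDeriv ν a x| ≤ K :=
  abs_le_of_enorm_le hK <| (le_iSup (fun x => ‖multiDeriv ν a x‖ₑ) x).trans
    ((supNorm_multiDeriv_le_holderNorm a hν).trans ha.2)

lemma abs_le_of_mem_holderBall {η K : ℝ} (hK : 0 ≤ K) {a : E d → ℝ}
    (ha : a ∈ HolderBall d η K) (x : E d) : |a x| ≤ K := by
  simpa [multiDeriv_zero] using abs_multiDeriv_le_of_mem_holderBall hK ha (ν := 0) (by simp) x

lemma norm_fderiv_le_of_mem_holderBall {K : ℝ} (hK : 0 ≤ K) {a : E d → ℝ}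
    (ha : a ∈ HolderBall d 1 K) (x : E d) : ‖fderiv ℝ a x‖ ≤ d * K := by
  refine ContinuousLinearMap.opNorm_le_bound _ (by positivity) fun v => ?_
  have hv : v = ∑ i, v i • EuclideanSpace.single i (1 : ℝ) := by
    simpa using ((EuclideanSpace.basisFun (Fin d) ℝ).sum_repr v).symm
  have hi : ∀ i : Fin d, |fderiv ℝ a x (EuclideanSpace.single i 1)| ≤ K := fun i => by
    have := abs_multiDeriv_le_of_mem_holderBall hK ha (ν := Pi.single i 1) (by simp) x
    rwa [multiDeriv_single] at this
  calc ‖fderiv ℝ a x v‖ = ‖∑ i, v i • fderiv ℝ a x (EuclideanSpace.single i (1 : ℝ))‖ := by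
        conv_lhs => rw [hv, map_sum]
        simp
    _ ≤ ∑ i : Fin d, ‖v‖ * K := by
        refine norm_sum_le_of_le _ fun i _ => ?_
        rw [norm_smul]
        exact mul_le_mul (PiLp.norm_apply_le v i) (hi i) (norm_nonneg _) (norm_nonneg _)
    _ = d * K * ‖v‖ := by simp; ring

/-- For `β = 1` the Lipschitz bound comes from the bound on the gradient, the Hölder seminorm of
exponent `0` of the first derivatives giving nothing more. -/
lemma abs_sub_le_of_mem_holderBall {β K : ℝ} (hK : 0 ≤ K) (hβ0 : 0 < β) (hβ1 : β ≤ 1)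
    {a : E d → ℝ} (ha : a ∈ HolderBall d β K) (x y : E d) :
    |a x - a y| ≤ (d + 1) * K * ‖x - y‖ ^ β := by
  rcases hβ1.eq_or_lt with rfl | hlt
  · have hdiff : Differentiable ℝ a := ha.1.differentiable (by simp)
    have := convex_univ.norm_image_sub_le_of_norm_fderiv_le (fun z _ => hdiff z)
      (fun z _ => norm_fderiv_le_of_mem_holderBall hK ha z) (mem_univ y) (mem_univ x)
    rw [Real.rpow_one]
    refine this.trans ?_
    gcongr
    linarith
  · have hfl : ⌊β⌋₊ = 0 := Nat.floor_eq_zero.2 hlt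
    rcases eq_or_ne x y with rfl | hxy
    · simp only [sub_self, abs_zero]; positivity
    have h1 : holderSeminorm β a ≤ ENNReal.ofReal K := by
      refine le_trans ?_ ha.2
      refine le_trans ?_ le_add_self
      simp only [hfl]
      simp [multiDeriv_zero]
    have h2 : ENNReal.ofReal (|a x - a y| / ‖x - y‖ ^ β) ≤ ENNReal.ofReal K :=
      le_trans (le_iSup_of_le x (le_iSup_of_le y
        (le_iSup (fun _ : x ≠ y => ENNReal.ofReal (|a x - a y| / ‖x - y‖ ^ β)) hxy))) h1
    rw [ENNReal.ofReal_le_ofReal_iff hK, div_le_iff₀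
      (Real.rpow_pos_of_pos (norm_pos_iff.2 (sub_ne_zero.2 hxy)) _)] at h2
    refine h2.trans ?_
    gcongr
    nlinarith [show (0 : ℝ) ≤ d * K by positivity]

lemma continuous_of_mem_holderBall {η K : ℝ} {a : E d → ℝ} (ha : a ∈ HolderBall d η K) :
    Continuous a := ha.1.continuous

/-! ### Log-concavity of the posterior densities -/

lemma norm_midpoint_sq (x y : E d) :
    ‖midpoint ℝ x y‖ ^ 2 = (‖x‖ ^ 2 + ‖y‖ ^ 2) / 2 - ‖x - y‖ ^ 2 / 4 := by
  rw [midpoint_eq_smul_add, norm_smul, mul_pow, norm_add_sq_real, norm_sub_sq_real]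
  norm_num
  ring

lemma iteratedDerivWithin_Ico_eq {u : ℝ → ℝ} {t : ℝ} (ht : t ∈ Ioo (0 : ℝ) 1) (l : ℕ) :
    iteratedDerivWithin l u (Ico 0 1) t = deriv^[l] u t := by
  rw [← iteratedDeriv_eq_iterate, ← iteratedDerivWithin_univ, iteratedDerivWithin,
    iteratedDerivWithin, iteratedFDerivWithin_congr_set]
  filter_upwards [isOpen_Ioo.mem_nhds ht] with s hs
  exact propext ⟨fun _ => mem_univ s, fun _ => Ioo_subset_Ico_self hs⟩

namespace OUScore.IsBallProfile

variable {β K : ℝ} {u : ℝ → ℝ}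

lemma differentiableOn (hu : IsBallProfile β K u) : DifferentiableOn ℝ u (Ico 0 1) := by
  refine hu.contDiffOn.differentiableOn ?_
  have : (⌊β⌋₊ + 1) ⊔ 2 ≠ 0 := by positivity
  exact_mod_cast this

lemma monotoneOn (hu : IsBallProfile β K u) : MonotoneOn u (Ico 0 1) := by
  refine monotoneOn_of_deriv_nonneg (convex_Ico 0 1) hu.contDiffOn.continuousOn
    (hu.differentiableOn.mono interior_subset) fun t ht => ?_
  rw [interior_Ico] at ht
  have h := hu.deriv_nonneg 1 (Finset.mem_Icc.2 ⟨le_rfl, by omega⟩) t (Ioo_subset_Ico_self ht)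
  rwa [iteratedDerivWithin_Ico_eq ht] at h

lemma convexOn (hu : IsBallProfile β K u) : ConvexOn ℝ (Ico 0 1) u := by
  have hc : ContDiffOn ℝ 2 u (Ioo 0 1) :=
    (hu.contDiffOn.of_le (by exact_mod_cast le_sup_right)).mono Ioo_subset_Ico_self
  refine convexOn_of_deriv2_nonneg (convex_Ico 0 1) hu.contDiffOn.continuousOn
    (hu.differentiableOn.mono interior_subset) ?_ fun t ht => ?_
  · rw [interior_Ico]
    exact (hc.deriv_of_isOpen (m := 1) isOpen_Ioo (by norm_num)).differentiableOn (by norm_num)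
  · rw [interior_Ico] at ht
    have h := hu.deriv_nonneg 2 (Finset.mem_Icc.2 ⟨by omega, by omega⟩) t (Ioo_subset_Ico_self ht)
    rwa [iteratedDerivWithin_Ico_eq ht] at h

/-- The potential `u (‖·‖ ^ 2)` of the unit ball is convex. -/
lemma apply_norm_midpoint_sq_le (hu : IsBallProfile β K u) {x y : E d} (hx : ‖x‖ < 1)
    (hy : ‖y‖ < 1) : ‖midpoint ℝ x y‖ < 1 ∧
      u (‖midpoint ℝ x y‖ ^ 2) ≤ (u (‖x‖ ^ 2) + u (‖y‖ ^ 2)) / 2 := by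
  have mem : ∀ z : E d, ‖z‖ < 1 → ‖z‖ ^ 2 ∈ Ico (0 : ℝ) 1 := fun z hz =>
    ⟨by positivity, by nlinarith [norm_nonneg z]⟩
  have hle : ‖midpoint ℝ x y‖ ^ 2 ≤ (1 / 2 : ℝ) • ‖x‖ ^ 2 + (1 / 2 : ℝ) • ‖y‖ ^ 2 := by
    rw [norm_midpoint_sq, smul_eq_mul, smul_eq_mul]
    linarith [sq_nonneg ‖x - y‖]
  have hmem := (convex_Ico (0 : ℝ) 1) (mem x hx) (mem y hy) (by norm_num : (0 : ℝ) ≤ 1 / 2)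
    (by norm_num : (0 : ℝ) ≤ 1 / 2) (by norm_num)
  have hz : ‖midpoint ℝ x y‖ < 1 := by
    have := hle.trans_lt hmem.2
    nlinarith [norm_nonneg (midpoint ℝ x y)]
  refine ⟨hz, (hu.monotoneOn (mem _ hz) hmem hle).trans ?_⟩
  have := hu.convexOn.2 (mem x hx) (mem y hy) (by norm_num : (0 : ℝ) ≤ 1 / 2)
    (by norm_num : (0 : ℝ) ≤ 1 / 2) (by norm_num)
  refine this.trans_eq ?_
  simp only [smul_eq_mul]
  ring

end OUScore.IsBallProfile

lemma posteriorWeight_mul_le {g : E d → ℝ} {κ m w τ : ℝ} (hw : 0 < w)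
    (hτ : 1 / τ ^ 2 = κ + m ^ 2 / w)
    (hκ : ∀ y z, g y * g z ≤ g (midpoint ℝ y z) ^ 2 * Real.exp (-(κ * ‖y - z‖ ^ 2 / 4)))
    (x y z : E d) : posteriorWeight g m w x y * posteriorWeight g m w x z ≤
      posteriorWeight g m w x (midpoint ℝ y z) ^ 2 * Real.exp (-(‖y - z‖ ^ 2 / (4 * τ ^ 2))) := by
  set e : E d → ℝ := fun y => -(m ^ 2 / (2 * w) * ‖y‖ ^ 2) + m / w * ⟪x, y⟫ with he
  have h1 : e y + e z = 2 * e (midpoint ℝ y z) - m ^ 2 / w * ‖y - z‖ ^ 2 / 4 := by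
    simp only [he]
    rw [norm_midpoint_sq, midpoint_eq_smul_add, inner_smul_right, inner_add_right]
    norm_num
    field_simp
    ring
  have h2 : ‖y - z‖ ^ 2 / (4 * τ ^ 2) = κ * ‖y - z‖ ^ 2 / 4 + m ^ 2 / w * ‖y - z‖ ^ 2 / 4 := by
    rw [show ‖y - z‖ ^ 2 / (4 * τ ^ 2) = 1 / τ ^ 2 * ‖y - z‖ ^ 2 / 4 by ring, hτ]
    ring
  calc _ = g y * g z * Real.exp (e y + e z) := by
        rw [Real.exp_add]; simp only [posteriorWeight, he]; ring
    _ ≤ g (midpoint ℝ y z) ^ 2 * Real.exp (-(κ * ‖y - z‖ ^ 2 / 4)) * Real.exp (e y + e z) := by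
        exact mul_le_mul_of_nonneg_right (hκ y z) (Real.exp_pos _).le
    _ = g (midpoint ℝ y z) ^ 2 * Real.exp (2 * e (midpoint ℝ y z)) *
          Real.exp (-(‖y - z‖ ^ 2 / (4 * τ ^ 2))) := by
        rw [mul_assoc, mul_assoc, ← Real.exp_add, ← Real.exp_add, h1, h2]
        ring_nf
    _ = _ := by
        rw [two_mul, Real.exp_add]
        simp only [posteriorWeight, he]
        ring

/-- If `p * exp (-a)` is log-concave, with curvature `κ`, then the posterior densities of `p`
become strongly log-concave, with curvature `κ + m ^ 2 / w`, on removing the factor `exp a`. -/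
lemma isStronglyLogConcave_posteriorWeight {p a : E d → ℝ} (hp : IsProbDensity p)
    (ha : Measurable a) {B : ℝ} (haB : ∀ y, |a y| ≤ B) {κ m w τ : ℝ} (hm : 0 < m) (hw : 0 < w)
    (hτ : 1 / τ ^ 2 = κ + m ^ 2 / w)
    (hκ : ∀ y z, (p y * Real.exp (-a y)) * (p z * Real.exp (-a z)) ≤
      (p (midpoint ℝ y z) * Real.exp (-a (midpoint ℝ y z))) ^ 2 *
        Real.exp (-(κ * ‖y - z‖ ^ 2 / 4))) (x : E d) :
    IsStronglyLogConcave τ (posteriorWeight (fun y => p y * Real.exp (-a y)) m w x) := by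
  have hpm := hp.measurable
  have hg0 : ∀ y, 0 ≤ p y * Real.exp (-a y) := fun y => mul_nonneg (hp.nonneg y) (Real.exp_pos _).le
  have hgi : Integrable fun y => p y * Real.exp (-a y) := by
    refine hp.integrable.mul_bdd (c := Real.exp B) (by fun_prop)
      (Filter.Eventually.of_forall fun y => ?_)
    rw [Real.norm_of_nonneg (Real.exp_pos _).le]
    exact Real.exp_le_exp.2 (by linarith [(abs_le.1 (haB y)).1])
  have hi := integrable_posteriorWeight hgi hm hw
  refine ⟨measurable_posteriorWeight (by fun_prop) m w x, fun y => mul_nonneg (hg0 y)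
    (Real.exp_pos _).le, ?_, fun h => ?_, posteriorWeight_mul_le hw hτ hκ x⟩
  · have e : posteriorWeight (fun y => p y * Real.exp (-a y)) m w x = fun y => p y *
        (Real.exp (-a y) * Real.exp (-(m ^ 2 / (2 * w) * ‖y‖ ^ 2) + m / w * ⟪x, y⟫)) := by
      ext y; simp only [posteriorWeight, mul_assoc]
    have hi' := hi x
    rw [e] at hi' ⊢
    exact integral_mul_pos_of_forall_pos hp (fun y => by positivity) hi'
  · have := hi (x + (1 : ℝ) • ((w / m) • h))
    refine this.congr (Filter.Eventually.of_forall fun y => ?_)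
    simp only
    rw [← posteriorWeight_mul_exp, inner_smul_left, conj_trivial]
    congr 2
    field_simp

/-- The second derivative bound for Gaussian mixtures of a density whose logarithm is, up to a
Hölder function, concave with curvature `κ`. -/
lemma iteratedDeriv_two_log_integral_gaussianDensity_le_of_concave {p a : E d → ℝ}
    (hp : IsProbDensity p) {β K : ℝ} (hK : 0 ≤ K) (hβ0 : 0 < β) (hβ1 : β ≤ 1)
    (ha : a ∈ HolderBall d β K) {κ m w τ : ℝ} (hm : 0 < m) (hw : 0 < w) (hτ0 : 0 < τ)
    (hτ : 1 / τ ^ 2 = κ + m ^ 2 / w)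
    (hκ : ∀ y z, (p y * Real.exp (-a y)) * (p z * Real.exp (-a z)) ≤
      (p (midpoint ℝ y z) * Real.exp (-a (midpoint ℝ y z))) ^ 2 *
        Real.exp (-(κ * ‖y - z‖ ^ 2 / 4))) (x v : E d) :
    iteratedDeriv 2
        (fun s : ℝ => Real.log (∫ y, p y * gaussianDensity (m • y) w (x + s • v))) 0 ≤
      (-(1 / w) + m ^ 2 / w ^ 2 * (τ ^ 2 *
        (1 + tiltConst d (2 * K) ((d + 1) * K) * τ ^ β))) * ‖v‖ ^ 2 := by
  have ham := (continuous_of_mem_holderBall ha).measurable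
  have haB := abs_le_of_mem_holderBall hK ha
  have hq := isStronglyLogConcave_posteriorWeight hp ham haB hm hw hτ hκ x
  obtain ⟨k, hk⟩ := hq.exists_integral_inner_sub_sq_le hτ0 ham (by positivity) hβ0 hβ1 haB
    (abs_sub_le_of_mem_holderBall hK hβ0 hβ1 ha) v
  have e : ∀ y, posteriorWeight (fun y => p y * Real.exp (-a y)) m w x y * Real.exp (a y) =
      posteriorWeight p m w x y := fun y => by
    have h : Real.exp (-a y) * Real.exp (a y) = 1 := by rw [← Real.exp_add]; simp
    simp only [posteriorWeight]
    calc _ = p y * (Real.exp (-a y) * Real.exp (a y)) *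
          Real.exp (-(m ^ 2 / (2 * w) * ‖y‖ ^ 2) + m / w * ⟪x, y⟫) := by ring
      _ = _ := by rw [h, mul_one]
  simp only [e] at hk
  refine (iteratedDeriv_two_log_integral_gaussianDensity_le hp hm hw x v hk).trans_eq ?_
  ring

/-! ### Elementary bounds in time -/

lemma one_sub_exp_pos {t : ℝ} (ht : 0 < t) : 0 < 1 - Real.exp (-2 * t) :=
  sub_pos.2 (Real.exp_lt_one_iff.2 (by linarith))

lemma div_two_le_one_sub_exp {t : ℝ} (ht : 0 ≤ t) (ht1 : t ≤ 1) :
    t / 2 ≤ 1 - Real.exp (-2 * t) := by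
  have h1 := Real.add_one_le_exp (2 * t)
  have h2 : Real.exp (-2 * t) * Real.exp (2 * t) = 1 := by rw [← Real.exp_add]; simp
  have h3 := Real.exp_pos (-2 * t)
  have h4 : Real.exp (-2 * t) * (2 * t + 1) ≤ 1 := by nlinarith
  nlinarith

lemma half_le_one_sub_exp {t : ℝ} (ht1 : 1 ≤ t) : 1 / 2 ≤ 1 - Real.exp (-2 * t) := by
  have h1 := div_two_le_one_sub_exp zero_le_one (le_refl (1 : ℝ))
  exact h1.trans (sub_le_sub_left (Real.exp_le_exp.2 (by linarith)) 1)

lemma one_sub_exp_rpow_le {t e : ℝ} (ht : 0 < t) (he : e ≤ 0) (he1 : -1 ≤ e) :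
    (1 - Real.exp (-2 * t)) ^ e ≤ 2 * (1 + t ^ e) := by
  have hte : 0 < t ^ e := Real.rpow_pos_of_pos ht e
  have h2 : (1 / 2 : ℝ) ^ e ≤ 2 := by
    have := Real.rpow_le_rpow_of_exponent_ge (by norm_num : (0 : ℝ) < 1 / 2) (by norm_num) he1
    refine this.trans ?_
    rw [Real.rpow_neg_one]; norm_num
  rcases le_total t 1 with h | h
  · have h1 := Real.rpow_le_rpow_of_nonpos (by positivity) (div_two_le_one_sub_exp ht.le h) he
    rw [div_eq_mul_one_div, Real.mul_rpow ht.le (by norm_num)] at h1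
    nlinarith
  · have h1 := Real.rpow_le_rpow_of_nonpos (by norm_num) (half_le_one_sub_exp h) he
    linarith

lemma integrableOn_exp_neg_mul_one_add_rpow (C : ℝ) {β : ℝ} (hβ : 0 < β) :
    IntegrableOn (fun t : ℝ => C * Real.exp (-t) * (1 + t ^ (β / 2 - 1))) (Ioi 0) := by
  have h1 := integrableOn_exp_neg_Ioi 0
  have h2 := Real.GammaIntegral_convergent (s := β / 2) (by positivity)
  refine ((h1.add h2).const_mul C).congr (Filter.Eventually.of_forall fun t => ?_)
  simp only [Pi.add_apply]
  ring

/-! ### Second derivative bounds for the two families of potentials -/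

/-- The constant `C` of the one-sided Lipschitz bound. The factor `18` collects the losses
`w ^ (β / 2 - 1) ≤ 2 * (1 + t ^ (β / 2 - 1))` and `m ^ (-β), m⁻¹ ≤ 3` of a ball potential at times
`t ≤ 1`; the summand `4` bounds `w⁻²` at times `t ≥ 1`. -/
noncomputable def scoreConst (d : ℕ) (K : ℝ) : ℝ := 18 * tiltConst d (2 * K) ((d + 1) * K) + 4

lemma scoreConst_pos {K : ℝ} (hK : 0 ≤ K) : 0 < scoreConst d K := by
  have := tiltConst_nonneg (d := d) (B := 2 * K) (H := (d + 1) * K) (by positivity)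
  unfold scoreConst; linarith

section Bounds

variable {p a : E d → ℝ} {β K t : ℝ}

/-- The curvature `1` of the Gaussian factor adds to that of the likelihood, so the reference
posterior is exactly Gaussian, of covariance `(1 - exp (-2 * t)) Id`. -/
lemma iteratedDeriv_two_log_ouDensity_le_of_gaussian (hp : IsProbDensity p) (hK : 0 ≤ K)
    (hβ0 : 0 < β) (hβ1 : β ≤ 1) (ha : a ∈ HolderBall d β K) (h : HasGaussianPotential p a)
    (ht : 0 < t) (x v : E d) :
    iteratedDeriv 2 (fun s : ℝ => Real.log (ouDensity p t (x + s • v))) 0 ≤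
      (scoreConst d K * Real.exp (-t) * (1 + t ^ (β / 2 - 1)) - 1) * ‖v‖ ^ 2 := by
  set w := 1 - Real.exp (-2 * t) with hwdef
  set m := Real.exp (-t) with hmdef
  have hm : 0 < m := Real.exp_pos _
  have hm1 : m ≤ 1 := Real.exp_le_one_iff.2 (by linarith)
  have hmw : m ^ 2 = 1 - w := by
    rw [hwdef, hmdef, ← Real.exp_nat_mul]; push_cast; ring_nf
  have hw : 0 < w := one_sub_exp_pos ht
  have hA := tiltConst_nonneg (d := d) (B := 2 * K) (H := (d + 1) * K) (by positivity)
  have hκ : ∀ y z, (p y * Real.exp (-a y)) * (p z * Real.exp (-a z)) ≤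
      (p (midpoint ℝ y z) * Real.exp (-a (midpoint ℝ y z))) ^ 2 *
        Real.exp (-(1 * ‖y - z‖ ^ 2 / 4)) := fun y z => by
    have e : ∀ y, p y * Real.exp (-a y) = Real.exp (-(‖y‖ ^ 2 / 2)) := fun y => by
      rw [h y, ← Real.exp_add]; ring_nf
    rw [e, e, e, ← Real.exp_add, ← Real.exp_nat_mul, ← Real.exp_add, norm_midpoint_sq]
    refine le_of_eq (congrArg _ ?_)
    push_cast
    ring
  have hτ2 : Real.sqrt w ^ 2 = w := Real.sq_sqrt hw.le
  have key := iteratedDeriv_two_log_integral_gaussianDensity_le_of_concave hp hK hβ0 hβ1 ha hm hw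
    (Real.sqrt_pos.2 hw) (κ := 1) (by rw [hτ2, hmw]; field_simp; ring) hκ x v
  refine key.trans (mul_le_mul_of_nonneg_right ?_ (sq_nonneg _))
  have hpow : Real.sqrt w ^ β / w = w ^ (β / 2 - 1) := by
    rw [Real.sqrt_eq_rpow, ← Real.rpow_mul hw.le, Real.rpow_sub_one hw.ne']
    ring_nf
  have hle := one_sub_exp_rpow_le ht (e := β / 2 - 1) (by linarith) (by linarith)
  rw [← hwdef, ← hpow] at hle
  rw [hτ2]
  set A := tiltConst d (2 * K) ((d + 1) * K)
  set R := Real.sqrt w ^ β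
  have hte : 0 < t ^ (β / 2 - 1) := Real.rpow_pos_of_pos ht _
  -- the leading terms add up to `-1` because `m ^ 2 + w = 1`
  have e1 : -(1 / w) + m ^ 2 / w ^ 2 * (w * (1 + A * R)) = m ^ 2 * (A * (R / w)) - 1 := by
    have : -(1 / w) + m ^ 2 / w ^ 2 * (w * (1 + A * R)) =
        m ^ 2 * (A * (R / w)) - (1 - m ^ 2) / w := by field_simp; ring
    rw [this, hmw, sub_sub_cancel, div_self hw.ne']
  rw [e1]
  refine sub_le_sub_right ?_ 1
  calc m ^ 2 * (A * (R / w)) ≤ m * (A * (2 * (1 + t ^ (β / 2 - 1)))) := by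
        gcongr
        nlinarith
    _ = (2 * A) * (m * (1 + t ^ (β / 2 - 1))) := by ring
    _ ≤ scoreConst d K * (m * (1 + t ^ (β / 2 - 1))) := by
        gcongr
        show 2 * A ≤ 18 * A + 4
        linarith
    _ = _ := by ring

lemma mul_exp_neg_midpoint_le_of_ball (h : HasBallPotential β K p a)
    (y z : E d) : (p y * Real.exp (-a y)) * (p z * Real.exp (-a z)) ≤
      (p (midpoint ℝ y z) * Real.exp (-a (midpoint ℝ y z))) ^ 2 *
        Real.exp (-(0 * ‖y - z‖ ^ 2 / 4)) := by
  obtain ⟨u, hu, h1, h2⟩ := h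
  have e : ∀ y, ‖y‖ < 1 → p y * Real.exp (-a y) = Real.exp (-u (‖y‖ ^ 2)) := fun y hy => by
    rw [h1 y hy, ← Real.exp_add]; ring_nf
  rcases lt_or_ge ‖y‖ 1 with hy | hy
  · rcases lt_or_ge ‖z‖ 1 with hz | hz
    · obtain ⟨hyz, hle⟩ := hu.apply_norm_midpoint_sq_le hy hz
      rw [e y hy, e z hz, e _ hyz, ← Real.exp_add, ← Real.exp_nat_mul, ← Real.exp_add]
      refine Real.exp_le_exp.2 ?_
      push_cast
      linarith
    · rw [h2 z hz, zero_mul, mul_zero]; positivity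
  · rw [h2 y hy, zero_mul, zero_mul]; positivity

lemma iteratedDeriv_two_log_ouDensity_le_of_ball_of_le_one (hp : IsProbDensity p) (hK : 0 ≤ K)
    (hβ0 : 0 < β) (hβ1 : β ≤ 1) (ha : a ∈ HolderBall d β K) (h : HasBallPotential β K p a)
    (ht : 0 < t) (ht1 : t ≤ 1) (x v : E d) :
    iteratedDeriv 2 (fun s : ℝ => Real.log (ouDensity p t (x + s • v))) 0 ≤
      (scoreConst d K * Real.exp (-t) * (1 + t ^ (β / 2 - 1)) - 1) * ‖v‖ ^ 2 := by
  set w := 1 - Real.exp (-2 * t) with hwdef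
  set m := Real.exp (-t) with hmdef
  have hm : 0 < m := Real.exp_pos _
  have hm1 : m ≤ 1 := Real.exp_le_one_iff.2 (by linarith)
  -- for `t ≤ 1` powers of `m` between `m` and `1` are absorbed into the constant
  have hm3 : 1 ≤ 3 * m := by
    have h1 : m * Real.exp t = 1 := by rw [hmdef, ← Real.exp_add]; simp
    have h2 : Real.exp t ≤ 3 := (Real.exp_le_exp.2 ht1).trans
      (Real.exp_one_lt_d9.le.trans (by norm_num))
    nlinarith
  have hw : 0 < w := one_sub_exp_pos ht
  have hA := tiltConst_nonneg (d := d) (B := 2 * K) (H := (d + 1) * K) (by positivity)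
  have hsw := Real.sqrt_pos.2 hw
  have hτ2 : (Real.sqrt w / m) ^ 2 = w / m ^ 2 := by rw [div_pow, Real.sq_sqrt hw.le]
  have key := iteratedDeriv_two_log_integral_gaussianDensity_le_of_concave hp hK hβ0 hβ1 ha hm hw
    (div_pos hsw hm) (κ := 0) (by rw [hτ2]; field_simp; ring)
    (mul_exp_neg_midpoint_le_of_ball h) x v
  refine key.trans (mul_le_mul_of_nonneg_right ?_ (sq_nonneg _))
  have hpow : Real.sqrt w ^ β / w = w ^ (β / 2 - 1) := by
    rw [Real.sqrt_eq_rpow, ← Real.rpow_mul hw.le, Real.rpow_sub_one hw.ne']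
    ring_nf
  have hle := one_sub_exp_rpow_le ht (e := β / 2 - 1) (by linarith) (by linarith)
  rw [← hwdef, ← hpow] at hle
  have hmβ : m ≤ m ^ β := by
    simpa using Real.rpow_le_rpow_of_exponent_ge hm hm1 hβ1
  have hmβ3 : 1 / m ^ β ≤ 3 := by
    rw [div_le_iff₀ (Real.rpow_pos_of_pos hm _)]
    linarith
  rw [hτ2, Real.div_rpow hsw.le hm.le]
  set A := tiltConst d (2 * K) ((d + 1) * K)
  set R := Real.sqrt w ^ β
  set S := 1 + t ^ (β / 2 - 1) with hS
  have hS1 : 1 ≤ S := by have := Real.rpow_pos_of_pos ht (β / 2 - 1); linarith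
  have hmβ0 : 0 < m ^ β := Real.rpow_pos_of_pos hm _
  have hRw : 0 ≤ R / w := by rw [hpow]; positivity
  have e1 : -(1 / w) + m ^ 2 / w ^ 2 * (w / m ^ 2 * (1 + A * (R / m ^ β))) =
      A * (R / w) * (1 / m ^ β) := by field_simp; ring
  rw [e1, le_sub_iff_add_le]
  calc A * (R / w) * (1 / m ^ β) + 1 ≤ A * (2 * S) * 3 + 1 := by gcongr
    _ ≤ (A * (2 * S) * 3 + S) * (3 * m) := by
        have : 0 ≤ A * (2 * S) * 3 := by positivity
        nlinarith
    _ = (18 * A + 3) * m * S := by ring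
    _ ≤ scoreConst d K * m * S := by
        gcongr
        show 18 * A + 3 ≤ 18 * A + 4
        linarith

/-- For large times it is enough that the posterior is supported in the unit ball. -/
lemma iteratedDeriv_two_log_ouDensity_le_of_ball_of_one_le (hp : IsProbDensity p) (hK : 0 ≤ K)
    (h : HasBallPotential β K p a) (ht1 : 1 ≤ t) (x v : E d) :
    iteratedDeriv 2 (fun s : ℝ => Real.log (ouDensity p t (x + s • v))) 0 ≤
      (scoreConst d K * Real.exp (-t) * (1 + t ^ (β / 2 - 1)) - 1) * ‖v‖ ^ 2 := by
  obtain ⟨u, -, -, h2⟩ := h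
  set w := 1 - Real.exp (-2 * t) with hwdef
  set m := Real.exp (-t) with hmdef
  have ht : 0 < t := by linarith
  have hm : 0 < m := Real.exp_pos _
  have hm1 : m ≤ 1 := Real.exp_le_one_iff.2 (by linarith)
  have hmw : m ^ 2 = 1 - w := by
    rw [hwdef, hmdef, ← Real.exp_nat_mul]; push_cast; ring_nf
  have hw2 : 1 / 2 ≤ w := half_le_one_sub_exp ht1
  have hw : 0 < w := by linarith
  have hA := tiltConst_nonneg (d := d) (B := 2 * K) (H := (d + 1) * K) (by positivity)
  have hi := integrable_posteriorWeight hp.integrable hm hw x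
  have hV : ∫ y, (⟪v, y⟫ - 0) ^ 2 * posteriorWeight p m w x y ≤
      ‖v‖ ^ 2 * ∫ y, posteriorWeight p m w x y := by
    rw [← integral_const_mul]
    refine integral_mono_of_nonneg (Filter.Eventually.of_forall fun y => ?_) (hi.const_mul _)
      (Filter.Eventually.of_forall fun y => ?_)
    · exact mul_nonneg (sq_nonneg _) (mul_nonneg (hp.nonneg y) (Real.exp_pos _).le)
    · simp only [posteriorWeight, sub_zero]
      rcases lt_or_ge ‖y‖ 1 with hy | hy
      · refine mul_le_mul_of_nonneg_right ?_ (mul_nonneg (hp.nonneg y) (Real.exp_pos _).le)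
        rw [← sq_abs]
        refine pow_le_pow_left₀ (abs_nonneg _) ((abs_real_inner_le_norm v y).trans ?_) 2
        exact mul_le_of_le_one_right (norm_nonneg v) hy.le
      · rw [h2 y hy]; simp
  have key := iteratedDeriv_two_log_integral_gaussianDensity_le hp hm hw x v hV
  refine key.trans ?_
  rw [show -(‖v‖ ^ 2 / w) + m ^ 2 / w ^ 2 * ‖v‖ ^ 2 = (-(1 / w) + m ^ 2 / w ^ 2) * ‖v‖ ^ 2 by ring]
  refine mul_le_mul_of_nonneg_right ?_ (sq_nonneg _)
  have hte : 0 < t ^ (β / 2 - 1) := Real.rpow_pos_of_pos ht _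
  have h1w : 1 ≤ 1 / w := by rw [le_div_iff₀ hw]; nlinarith [sq_nonneg m]
  have hm2 : m ^ 2 / w ^ 2 ≤ 4 * m := by
    rw [div_le_iff₀ (by positivity)]
    have : 1 ≤ 4 * w ^ 2 := by nlinarith
    nlinarith
  have hC : 4 * m ≤ scoreConst d K * m * (1 + t ^ (β / 2 - 1)) := by
    have h4 : 4 ≤ scoreConst d K := by unfold scoreConst; linarith
    have h5 : 4 * m ≤ scoreConst d K * m := by gcongr
    nlinarith [mul_pos (mul_pos (scoreConst_pos (d := d) hK) hm) hte]
  linarith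

end Bounds

theorem mainTheorem7 (d : ℕ) (hd : 1 ≤ d) (β K : ℝ) (hβ0 : 0 < β) (hβ1 : β ≤ 1) (hK : 0 < K) :
    ∃ C : ℝ, 0 < C ∧
      IntegrableOn (fun t : ℝ => C * Real.exp (-t) * (1 + t ^ (β / 2 - 1))) (Ioi 0) ∧
      ∀ p a : E d → ℝ, IsProbDensity p → a ∈ HolderBall d β K →
        (HasGaussianPotential p a ∨ HasBallPotential β K p a) →
        ∀ t : ℝ, 0 < t →
          (∀ x, 0 < ouDensity p t x) ∧ ContDiff ℝ 2 (ouDensity p t) ∧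
          (⨆ x : E d, ((lambdaMax (fderiv ℝ (score p t) x + ContinuousLinearMap.id ℝ (E d)) : ℝ)
              : EReal)) ≤ ((C * Real.exp (-t) * (1 + t ^ (β / 2 - 1)) : ℝ) : EReal) ∧
          ∀ x y : E d, ⟪score p t x - score p t y, x - y⟫ ≤
            (C * Real.exp (-t) * (1 + t ^ (β / 2 - 1)) - 1) * ‖x - y‖ ^ 2 := by
  refine ⟨scoreConst d K, scoreConst_pos hK.le, integrableOn_exp_neg_mul_one_add_rpow _ hβ0,
    fun p a hp ha hpa t ht => ?_⟩
  have hw : 0 < 1 - Real.exp (-2 * t) := one_sub_exp_pos ht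
  have hpos : ∀ x, 0 < ouDensity p t x := fun x => by
    rw [ouDensity, integral_mul_gaussianDensity p hw]
    have := integral_posteriorWeight_pos hp (Real.exp_pos (-t)) hw x
    positivity
  have hcd : ContDiff ℝ 2 (ouDensity p t) :=
    contDiff_two_integral_gaussianDensity hp.integrable hw _
  have hlog : ContDiff ℝ 2 fun y => Real.log (ouDensity p t y) := hcd.log fun x => (hpos x).ne'
  have hM : ∀ x v : E d,
      iteratedDeriv 2 (fun s : ℝ => Real.log (ouDensity p t (x + s • v))) 0 ≤
        (scoreConst d K * Real.exp (-t) * (1 + t ^ (β / 2 - 1)) - 1) * ‖v‖ ^ 2 := by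
    rcases hpa with h | h
    · exact iteratedDeriv_two_log_ouDensity_le_of_gaussian hp hK.le hβ0 hβ1 ha h ht
    · rcases le_total t 1 with ht1 | ht1
      · exact iteratedDeriv_two_log_ouDensity_le_of_ball_of_le_one hp hK.le hβ0 hβ1 ha h ht ht1
      · exact iteratedDeriv_two_log_ouDensity_le_of_ball_of_one_le hp hK.le h ht1
  have hL : 0 ≤ scoreConst d K * Real.exp (-t) * (1 + t ^ (β / 2 - 1)) := by
    have := scoreConst_pos (d := d) hK.le
    positivity
  refine ⟨hpos, hcd, iSup_le fun x => EReal.coe_le_coe_iff.2 ?_, inner_gradient_sub_le hlog hM⟩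
  exact lambdaMax_fderiv_gradient_add_id_le hlog hL hM x
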